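/- For $x,q\in\mathbb{C}$ write $(x;q)_0=1$, $(x;q)_k=\prod_{r=0}^{k-1}(1-xq^r)$ for $k\ge 1$, and $$\left[\begin{matrix}a_1,\dots,a_r\\ b_1,\dots,b_s\end{matrix}\,\middle|\,q\right]_k=\frac{(a_1;q)_k\cdots(a_r;q)_k}{(b_1;q)_k\cdots(b_s;q)_k},\qquad {}_4\phi_3\left[\begin{matrix}a_0,a_1,a_2,a_3\\ b_1,b_2,b_3\end{matrix}\,\middle|\,q;z\right]=\sum_{k=0}^{\infty}\left[\begin{matrix}a_0,a_1,a_2,a_3\\ q,b_1,b_2,b_3\end{matrix}\,\middle|\,q\right]_k z^k,$$ and $\chi(k)=\{1+(-1)^k\}/2$. Let $q,a,c$ be nonzero complex numbers and $n,\ell,m$ nonnegative integers such that no zero factors appear in the denominators of the formula below. Then $$\begin{aligned} &{}_4\phi_3\left[\begin{matrix}q^{-n},\,a,\,c,\,-q^{1-\ell-m-n}/(ac)\\ q^{1-\ell-n}/a,\;q^{1-m-n}/c,\;-ac\end{matrix}\,\middle|\,q;q\right] =\left[\begin{matrix}a,\,q^{n}a^2\\ a^2,\,q^{n}a\end{matrix}\,\middle|\,q\right]_{\ell}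 \left[\begin{matrix}-a,\,q^{m}c^2\\ -ac,\,q^{m}c\end{matrix}\,\middle|\,q\right]_{n}\\ &\quad\times\sum_{i=0}^{\ell}\sum_{j=0}^{m}q^{(\ell+n)i+(m+n-i)j-\binom{j}{2}}\,a^i c^{\,n-i}\, \frac{1-q^{2i-1}a^2}{1-q^{-1}a^2} \left[\begin{matrix}q^{-\ell},\,q^{-n},\,q^{-1}a^2\\ q,\,q^{n}a^2,\,q^{\ell}a^2\end{matrix}\,\middle|\,q\right]_i\\ &\quad\times\left[\begin{matrix}q^{-m},\,q^{i-n},\,q^{1-n-i}/a^2,\,c,\,-c\\ q,\,q^{1-n}/a,\,-q^{1-n}/a,\,q^{m}c^2,\,q^{j-1}c^2\end{matrix}\,\middle|\,q\right]_j \left[\begin{matrix}q,\,q^{2-2n}/(a^2c^2)\\ q^{2-2n+2j}/a^2,\,q^{1+2j}c^2\end{matrix}\,\middle|\,q^2\right]_{\frac{n-i-j}{2}}\chi(n-i-j). \end{aligned}$$ Here the series on the left terminates: it is the sum of its terms with $k\le n$. The summands on the right with $i+j>n$ (which contain the zero factor $(q^{-n};q)_i(q^{i-n};q)_j$) and those with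 $n-i-j$ odd (for which $\chi(n-i-j)=0$) are read as $0$. The condition on denominators concerns only the remaining terms and the two factors in front of the double sum. -/

import Mathlib

open Finset BigOperators

noncomputable section

/-- The `q`-shifted factorial `(x;q)_n = ∏_{k<n} (1 - x q^k)`. -/
def qShift (q x : ℂ) (n : ℕ) : ℂ := ∏ k ∈ Finset.range n, (1 - x * q ^ k)

/-- The fraction form
`(a;q)_n (b;q)_n ⋯ (c;q)_n / ((α;q)_n (β;q)_n ⋯ (γ;q)_n)`,
where `num = [a, b, …, c]` and `den = [α, β, …, γ]`. -/
def qFrac (q : ℂ) (num den : List ℂ) (n : ℕ) : ℂ :=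
  (num.map fun x => qShift q x n).prod / (den.map fun x => qShift q x n).prod

/-- No zero factor appears in the denominator of `qFrac q num den n`. -/
def NoZeroFactor (q : ℂ) (den : List ℂ) (n : ℕ) : Prop :=
  ∀ x ∈ den, qShift q x n ≠ 0

/-- The basic hypergeometric series
`_{1+r}φ_r[a_0, …, a_r ; b_1, …, b_r | q; z] = ∑_k (a_0;q)_k ⋯ (a_r;q)_k / ((q;q)_k (b_1;q)_k ⋯) z^k`,
where `num = [a_0, …, a_r]` and `den = [b_1, …, b_r]`. -/
def basicHyp (q z : ℂ) (num den : List ℂ) : ℂ :=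
  ∑' k : ℕ, qFrac q num (q :: den) k * z ^ k

/-- The parity factor `χ(k) = (1 + (-1)^k) / 2`. -/
def parityChi (k : ℤ) : ℂ := (1 + (-1 : ℂ) ^ k) / 2

end

/-!
The left-hand series is balanced, so Sears' transformation (`sears`, obtained by using the
`q`-Saalschütz sum twice) turns it, up to the second prefactor, into the series `whippleSum` in which
the parameters are nearly paired up as `±c` and `±q^{1-n}/a`; the pairing is spoilt only by the
factors `q^ℓ` and `q^m`.

Each of these factors is removed by one and the same expansion, `sum_linearization`, the special case
`C² = Aq` of the terminating very-well-poised `₆φ₅` sum. Read backwards, it writes the quotient of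
shifted factorials that carries `q^ℓ` (respectively `q^m`) as a sum over `i` (respectively `j`) of
terms that merge with the `k`-th term of the series. After interchanging summations the `i`-th inner
sum is again a `whippleSum`, with `n`, `a` replaced by `n - i`, `q^i a` and without `q^ℓ`
(`whippleSum_eq_sum_whippleSum_one`), and the `j`-th one is the series of Andrews' terminating
`q`-Watson formula (`whippleSum_one_eq_sum_watsonSum`), which vanishes for odd order and is a product
for even order (`watsonSum_odd`, `watsonSum_even`).

The basic summations are proved by creative telescoping: for a summand `T(z, k)` with `z = q^{-n}`
and the ratio `ρ(z)` of consecutive right-hand sides, the partial sums of `T(z/q, k) - ρ(z) T(z, k)`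
have a closed product form, which vanishes as soon as the range of summation exceeds `n`.

The argument divides by shifted factorials that do not occur in the statement. It is therefore run
for parameters no relevant monomial of which is a power of `q`, with `q` itself fixed. Along the curve
`t ↦ (a t, c t³)` all but countably many `t` give such parameters, and both sides are continuous at
`t = 1` because the denominators of the statement do not vanish there.
-/

/-! ### Shifted factorials and generic parameters -/

theorem qShift_zero (q x : ℂ) : qShift q x 0 = 1 := by simp [qShift]

theorem qShift_one (q x : ℂ) : qShift q x 1 = 1 - x := by simp [qShift]

theorem qShift_succ (q x : ℂ) (n : ℕ) :
    qShift q x (n + 1) = qShift q x n * (1 - x * q ^ n) := by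
  simp [qShift, Finset.prod_range_succ]

theorem qShift_succ_left (q x : ℂ) (n : ℕ) :
    qShift q x (n + 1) = (1 - x) * qShift q (x * q) n := by
  simp only [qShift, Finset.prod_range_succ', pow_zero, mul_one]
  rw [mul_comm]
  congr 1
  exact Finset.prod_congr rfl fun k _ => by ring

theorem qShift_add (q x : ℂ) (m n : ℕ) :
    qShift q x (m + n) = qShift q x m * qShift q (x * q ^ m) n := by
  simp [qShift, Finset.prod_range_add, pow_add, mul_assoc]

theorem qShift_ne_zero_iff {q x : ℂ} {n : ℕ} :
    qShift q x n ≠ 0 ↔ ∀ k < n, 1 - x * q ^ k ≠ 0 := by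
  simp [qShift, Finset.prod_ne_zero_iff]

theorem qShift_ne_zero_of_le {q x : ℂ} {m n : ℕ} (h : qShift q x n ≠ 0) (hmn : m ≤ n) :
    qShift q x m ≠ 0 :=
  qShift_ne_zero_iff.2 fun k hk => qShift_ne_zero_iff.1 h k (hk.trans_le hmn)

theorem qShift_zpow_neg_eq_zero {q : ℂ} (hq : q ≠ 0) {n k : ℕ} (h : n < k) :
    qShift q (q ^ (-n : ℤ)) k = 0 := by
  refine Finset.prod_eq_zero (Finset.mem_range.2 h) ?_
  rw [zpow_neg, zpow_natCast, inv_mul_cancel₀ (pow_ne_zero _ hq), sub_self]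

theorem qShift_mul_neg (q x : ℂ) (n : ℕ) :
    qShift q x n * qShift q (-x) n = qShift (q ^ 2) (x ^ 2) n := by
  simp only [qShift, ← Finset.prod_mul_distrib]
  refine Finset.prod_congr rfl fun k _ => ?_
  ring

/-- `x` is not an integral power of `q`. The condition is invariant under `x ↦ x q^r`, and no shifted
factorial `(x q^r; q)_k` vanishes under it. It says nothing about `q`, which may be a root of unity. -/
def QGeneric (q x : ℂ) : Prop := ∀ r : ℤ, x * q ^ r ≠ 1

namespace QGeneric

variable {q x y : ℂ}

theorem one_sub_ne_zero (h : QGeneric q x) : 1 - x ≠ 0 :=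
  sub_ne_zero.2 fun e => h 0 (by simp [← e])

theorem shift (hq : q ≠ 0) (h : QGeneric q x) (r : ℤ) (e : y = x * q ^ r) : QGeneric q y := by
  intro s hs
  refine h (r + s) ?_
  rw [zpow_add₀ hq, ← mul_assoc, ← e, hs]

theorem inv (h : QGeneric q x) : QGeneric q x⁻¹ := by
  intro r hr
  have hx : x ≠ 0 := by rintro rfl; simp at hr
  refine h (-r) ?_
  rw [zpow_neg]
  field_simp at hr
  rw [hr, mul_inv_cancel₀ hx]

theorem of_sq (h : QGeneric q (x ^ 2)) : QGeneric q x := by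
  intro r hr
  refine h (2 * r) ?_
  rw [mul_comm 2 r, zpow_mul, show (2 : ℤ) = ((2 : ℕ) : ℤ) by rfl, zpow_natCast, ← mul_pow, hr,
    one_pow]

theorem neg_of_sq (h : QGeneric q (x ^ 2)) : QGeneric q (-x) :=
  of_sq (by rwa [neg_sq])

theorem base_sq (h : QGeneric q x) : QGeneric (q ^ 2) x := by
  intro r hr
  refine h (2 * r) ?_
  rwa [zpow_mul]

theorem one_sub_mul_pow_ne_zero (h : QGeneric q x) (k : ℕ) : 1 - x * q ^ k ≠ 0 :=
  sub_ne_zero.2 fun e => h k (by rw [zpow_natCast, ← e])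

theorem qShift_ne_zero (h : QGeneric q x) (n : ℕ) : qShift q x n ≠ 0 :=
  qShift_ne_zero_iff.2 fun k _ => h.one_sub_mul_pow_ne_zero k

end QGeneric

theorem one_sub_pow_ne_zero {q : ℂ} {n k : ℕ} (h : qShift q q n ≠ 0) (hk : k < n) :
    1 - q * q ^ k ≠ 0 := qShift_ne_zero_iff.1 h k hk

/-- Reversal of a shifted factorial: the factors of `(q^{1-n}/x; q)_k` are, up to monomials, the last
`k` factors of `(x; q)_n`. -/
theorem qShift_reverse {q x : ℂ} (hq : q ≠ 0) (hx : x ≠ 0) {n k : ℕ} (hk : k ≤ n) :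
    qShift q (q ^ (1 - n : ℤ) / x) k * qShift q x (n - k) =
      qShift q x n * ((-q / x) ^ k * (q ^ k.choose 2 / q ^ (n * k))) := by
  induction k with
  | zero => simp [qShift_zero]
  | succ k ih =>
    obtain ⟨d, rfl⟩ := Nat.exists_eq_add_of_le hk
    have e1 : k + 1 + d - k = d + 1 := by omega
    have e2 : k + 1 + d - (k + 1) = d := by omega
    specialize ih (by omega)
    rw [e1, qShift_succ q x d] at ih
    rw [e2, qShift_succ, Nat.choose_succ_succ' k 1, Nat.choose_one_right]
    have e3 : 1 - q ^ (1 - (k + 1 + d : ℕ) : ℤ) / x * q ^ k =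
        (1 - x * q ^ d) * (-q / x * (q ^ k / q ^ (k + 1 + d))) := by
      rw [zpow_sub₀ hq, zpow_natCast]
      field_simp
      ring
    rw [e3]
    calc _ = (qShift q (q ^ (1 - (k + 1 + d : ℕ) : ℤ) / x) k *
          (qShift q x d * (1 - x * q ^ d))) * (-q / x * (q ^ k / q ^ (k + 1 + d))) := by ring
      _ = _ := by
        rw [ih, pow_succ, pow_add, mul_add, pow_add q _ (_ * 1), mul_one]
        ring_nf

/-! ### Terminating sums with a telescoping proof -/

/-- Telescoping identity for the `₆φ₅` sum: `z` stands for `q^{-N}`, the first summand is the one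
for `N + 1`, and the coefficient of the second is the ratio of the right-hand sides of
`sum_wellPoised` for `N + 1` and `N`. -/
theorem sum_wellPoised_sub (q A B C z : ℂ) (hq : q ≠ 0) (hB : B ≠ 0) (hC : C ≠ 0) (hz : z ≠ 0)
    (hA : 1 - A ≠ 0) (hAB : QGeneric q (A * q / B)) (hAC : QGeneric q (A * q / C))
    (hAz : QGeneric q (A * q / z)) (h₁ : 1 - A * q / z / B ≠ 0) (h₂ : 1 - A * q / z / C ≠ 0)
    (K : ℕ) (hK : qShift q q K ≠ 0) :
    ∑ i ∈ range (K + 1), ((1 - A * q ^ (2 * i)) / (1 - A) *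
          (qShift q A i * qShift q B i * qShift q C i * qShift q (z / q) i) /
          (qShift q q i * qShift q (A * q / B) i * qShift q (A * q / C) i *
            qShift q (A * q / z * q) i) * (A * q / z * q / (B * C)) ^ i -
        (1 - A * q / z) * (1 - A * q / z / (B * C)) /
          ((1 - A * q / z / B) * (1 - A * q / z / C)) *
        ((1 - A * q ^ (2 * i)) / (1 - A) *
          (qShift q A i * qShift q B i * qShift q C i * qShift q z i) /
          (qShift q q i * qShift q (A * q / B) i * qShift q (A * q / C) i *
            qShift q (A * q / z) i) * (A * q / z / (B * C)) ^ i)) =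
      (1 - (1 - A * q / z) * (1 - A * q / z / (B * C)) /
          ((1 - A * q / z / B) * (1 - A * q / z / C))) *
        ((qShift q (A * q) K * qShift q (B * q) K * qShift q (C * q) K * qShift q z K) /
          (qShift q q K * qShift q (A * q / B) K * qShift q (A * q / C) K *
            qShift q (A * q / z * q) K) * (A * q / z / (B * C)) ^ K) := by
  induction K with
  | zero => simp [qShift_zero, hA]
  | succ K ih =>
    rw [Finset.sum_range_succ, ih (qShift_ne_zero_of_le hK (Nat.le_succ K))]
    have f1 := qShift_ne_zero_of_le hK (Nat.le_succ K)
    have f2 := hAB.qShift_ne_zero K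
    have f3 := hAC.qShift_ne_zero K
    have hx' : QGeneric q (A * q / z * q) := hAz.shift hq 1 (by simp)
    have f4 := hx'.qShift_ne_zero K
    have g1 := one_sub_pow_ne_zero hK (Nat.lt_succ_self K)
    have g2 := hAB.one_sub_mul_pow_ne_zero K
    have g3 := hAC.one_sub_mul_pow_ne_zero K
    have g4 := hx'.one_sub_mul_pow_ne_zero K
    have g5 := hAz.one_sub_ne_zero
    rw [qShift_succ_left q A, qShift_succ_left q B, qShift_succ_left q C, qShift_succ_left q (z / q),
      div_mul_cancel₀ _ hq, qShift_succ_left q (A * q / z), qShift_succ q q, qShift_succ q (A * q / B),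
      qShift_succ q (A * q / C), qShift_succ q (A * q / z * q), qShift_succ q z,
      qShift_succ q (A * q), qShift_succ q (B * q), qShift_succ q (C * q), mul_div_right_comm _ q (B * C),
      mul_pow]
    generalize qShift q (A * q) K = a at *
    generalize qShift q (B * q) K = b at *
    generalize qShift q (C * q) K = c at *
    generalize qShift q z K = d at *
    generalize qShift q q K = e at *
    generalize qShift q (A * q / B) K = f at *
    generalize qShift q (A * q / C) K = g at *
    generalize qShift q (A * q / z * q) K = h at *
    rw [mul_add 2, pow_add q, mul_comm 2 K, pow_mul, pow_succ q K, pow_succ _ K]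
    generalize (A * q / z / (B * C)) ^ K = m at *
    generalize q ^ K = p at *
    clear ih hAB hAC hAz hx' hK
    have g2' : B - A * q * p ≠ 0 := by
      intro h; apply g2; field_simp; linear_combination h
    have g3' : C - A * q * p ≠ 0 := by
      intro h; apply g3; field_simp; linear_combination h
    have g4' : z - A * q ^ 2 * p ≠ 0 := by
      intro h; apply g4; field_simp; linear_combination h
    have g5' : z - A * q ≠ 0 := by
      intro h; apply g5; field_simp; linear_combination h
    have h1' : z * B - A * q ≠ 0 := by
      intro h; apply h₁; field_simp; linear_combination h
    have h2' : z * C - A * q ≠ 0 := by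
      intro h; apply h₂; field_simp; linear_combination h
    field_simp
    ring

/-- The terminating very-well-poised `₆φ₅` sum. -/
theorem sum_wellPoised {q A B C : ℂ} (hq : q ≠ 0) (hB : B ≠ 0) (hC : C ≠ 0)
    (hA : QGeneric q A) (hAB : QGeneric q (A / B)) (hAC : QGeneric q (A / C)) (N : ℕ)
    (hN : qShift q q N ≠ 0) :
    ∑ i ∈ range (N + 1), (1 - A * q ^ (2 * i)) / (1 - A) *
        (qShift q A i * qShift q B i * qShift q C i * qShift q (q ^ (-N : ℤ)) i) /
        (qShift q q i * qShift q (A * q / B) i * qShift q (A * q / C) i *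
          qShift q (A * q * q ^ N) i) * (A * q * q ^ N / (B * C)) ^ i =
      qShift q (A * q) N * qShift q (A * q / (B * C)) N /
        (qShift q (A * q / B) N * qShift q (A * q / C) N) := by
  have hA1 := hA.one_sub_ne_zero
  induction N with
  | zero => simp [qShift_zero, hA1]
  | succ N ih =>
    specialize ih (qShift_ne_zero_of_le hN (Nat.le_succ N))
    have hAB' : QGeneric q (A * q / B) := hAB.shift hq 1 (by rw [zpow_one]; ring)
    have hAC' : QGeneric q (A * q / C) := hAC.shift hq 1 (by rw [zpow_one]; ring)
    have e1 : A * q / q ^ (-N : ℤ) = A * q * q ^ N := by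
      rw [zpow_neg, div_inv_eq_mul, zpow_natCast]
    have e2 : q ^ (-N : ℤ) / q = q ^ (-(N + 1 : ℕ) : ℤ) := by
      rw [Nat.cast_succ, neg_add, ← sub_eq_add_neg, zpow_sub_one₀ hq, div_eq_mul_inv]
    have h₁ : 1 - A * q * q ^ N / B ≠ 0 := by
      rw [mul_div_right_comm]; exact hAB'.one_sub_mul_pow_ne_zero N
    have h₂ : 1 - A * q * q ^ N / C ≠ 0 := by
      rw [mul_div_right_comm]; exact hAC'.one_sub_mul_pow_ne_zero N
    -- The closed form at `K = N + 1` contains the factor `(q^{-N}; q)_{N+1} = 0`.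
    have key := sum_wellPoised_sub q A B C (q ^ (-N : ℤ)) hq hB hC (zpow_ne_zero _ hq) hA1
      hAB' hAC' (e1 ▸ hA.shift hq (N + 1) (by rw [zpow_add_one₀ hq, zpow_natCast]; ring))
      (e1 ▸ h₁) (e1 ▸ h₂) (N + 1) hN
    rw [e1, e2, qShift_zpow_neg_eq_zero hq (Nat.lt_succ_self N), mul_zero, zero_div, zero_mul,
      mul_zero, sum_sub_distrib, sub_eq_zero, ← mul_sum, sum_range_succ _ (N + 1),
      sum_range_succ _ (N + 1), qShift_zpow_neg_eq_zero hq (Nat.lt_succ_self N), mul_zero, mul_zero,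
      zero_div, zero_mul, add_zero, ih, ← sum_range_succ] at key
    rw [pow_succ, ← mul_assoc, key, qShift_succ, qShift_succ, qShift_succ, qShift_succ]
    rw [mul_div_right_comm _ (q ^ N) B, mul_div_right_comm _ (q ^ N) C,
      mul_div_right_comm _ (q ^ N) (B * C), div_mul_div_comm]
    congr 1 <;> ring

/-- Telescoping identity for the `q`-Saalschütz sum, with `z` standing for `q^{-n}`. -/
theorem sum_saalschutz_sub (q a b c z : ℂ) (hq : q ≠ 0) (ha : a ≠ 0) (hb : b ≠ 0) (hc : c ≠ 0)
    (hz : z ≠ 0) (hcq : QGeneric q c) (hd : QGeneric q (a * b * z / c))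
    (h₁ : 1 - c / z ≠ 0) (K : ℕ) (hK : qShift q q K ≠ 0) :
    ∑ k ∈ range (K + 1), ((qShift q (z / q) k * qShift q a k * qShift q b k) /
          (qShift q q k * qShift q c k * qShift q (a * b * z / c) k) * q ^ k -
        (1 - c / z / a) * (1 - c / z / b) / ((1 - c / z) * (1 - c / z / (a * b))) *
        ((qShift q z k * qShift q a k * qShift q b k) /
          (qShift q q k * qShift q c k * qShift q (a * b * z / c * q) k) * q ^ k)) =
      (1 - (1 - c / z / a) * (1 - c / z / b) / ((1 - c / z) * (1 - c / z / (a * b)))) *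
        ((qShift q z K * qShift q (a * q) K * qShift q (b * q) K) /
          (qShift q q K * qShift q c K * qShift q (a * b * z / c * q) K)) := by
  induction K with
  | zero => simp [qShift_zero]
  | succ K ih =>
    rw [Finset.sum_range_succ, ih (qShift_ne_zero_of_le hK (Nat.le_succ K))]
    have hd' : QGeneric q (a * b * z / c * q) := hd.shift hq 1 (by simp)
    have f1 := qShift_ne_zero_of_le hK (Nat.le_succ K)
    have f2 := hcq.qShift_ne_zero K
    have f3 := hd'.qShift_ne_zero K
    have g1 := one_sub_pow_ne_zero hK (Nat.lt_succ_self K)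
    have g2 := hcq.one_sub_mul_pow_ne_zero K
    have g3 := hd'.one_sub_mul_pow_ne_zero K
    have g4 := hd.one_sub_ne_zero
    rw [qShift_succ_left q (z / q), div_mul_cancel₀ _ hq, qShift_succ_left q a,
      qShift_succ_left q b, qShift_succ_left q (a * b * z / c), qShift_succ q q, qShift_succ q c,
      qShift_succ q (a * b * z / c * q), qShift_succ q z, qShift_succ q (a * q),
      qShift_succ q (b * q)]
    generalize qShift q z K = s1 at *
    generalize qShift q (a * q) K = s2 at *
    generalize qShift q (b * q) K = s3 at *
    generalize qShift q q K = s4 at *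
    generalize qShift q c K = s5 at *
    generalize qShift q (a * b * z / c * q) K = s6 at *
    rw [pow_succ q K]
    generalize q ^ K = p at *
    clear ih hcq hd hd' hK
    have g3' : c - z * a * b * q * p ≠ 0 := by
      intro h; apply g3; field_simp; linear_combination h
    have g4' : c - z * a * b ≠ 0 := by
      intro h; apply g4; field_simp; linear_combination h
    have h1' : z - c ≠ 0 := by
      intro h; apply h₁; field_simp; linear_combination h
    have h2' : z * a * b - c ≠ 0 := by
      intro h; apply g4'; linear_combination -h
    field_simp
    ring

/-- The `q`-Saalschütz sum of a terminating balanced `₃φ₂`. -/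
theorem sum_saalschutz {q a b c : ℂ} (hq : q ≠ 0) (ha : a ≠ 0) (hb : b ≠ 0) (hc : c ≠ 0)
    (hcq : QGeneric q c) (hd : QGeneric q (a * b / c)) (n : ℕ) (hn : qShift q q n ≠ 0) :
    ∑ k ∈ range (n + 1), (qShift q (q ^ (-n : ℤ)) k * qShift q a k * qShift q b k) /
        (qShift q q k * qShift q c k * qShift q (a * b * q ^ (1 - n : ℤ) / c) k) * q ^ k =
      qShift q (c / a) n * qShift q (c / b) n / (qShift q c n * qShift q (c / (a * b)) n) := by
  induction n with
  | zero => simp [qShift_zero]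
  | succ n ih =>
    specialize ih (qShift_ne_zero_of_le hn (Nat.le_succ n))
    have e1 : c / q ^ (-n : ℤ) = c * q ^ n := by
      rw [zpow_neg, div_inv_eq_mul, zpow_natCast]
    have e2 : q ^ (-n : ℤ) / q = q ^ (-(n + 1 : ℕ) : ℤ) := by
      rw [Nat.cast_succ, neg_add, ← sub_eq_add_neg, zpow_sub_one₀ hq, div_eq_mul_inv]
    have e3 : a * b * q ^ (-n : ℤ) / c = a * b * q ^ (1 - (n + 1 : ℕ) : ℤ) / c := by
      rw [Nat.cast_succ, sub_add_cancel_right]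
    have e4 : a * b * q ^ (1 - (n + 1 : ℕ) : ℤ) / c * q = a * b * q ^ (1 - n : ℤ) / c := by
      rw [Nat.cast_succ, sub_add_cancel_right, sub_eq_neg_add, zpow_add_one₀ hq]; ring
    have key := sum_saalschutz_sub q a b c (q ^ (-n : ℤ)) hq ha hb hc (zpow_ne_zero _ hq) hcq
      (hd.shift hq (-n) (by ring)) (e1 ▸ hcq.one_sub_mul_pow_ne_zero n) (n + 1) hn
    rw [e1, e2, e3, e4, qShift_zpow_neg_eq_zero hq (Nat.lt_succ_self n), zero_mul, zero_mul,
      zero_div, mul_zero, sum_sub_distrib, sub_eq_zero, ← mul_sum, sum_range_succ _ (n + 1),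
      sum_range_succ _ (n + 1), qShift_zpow_neg_eq_zero hq (Nat.lt_succ_self n), zero_mul, zero_mul,
      zero_div, zero_mul, add_zero, ih, ← sum_range_succ] at key
    rw [key, qShift_succ, qShift_succ, qShift_succ, qShift_succ, mul_div_right_comm _ (q ^ n) a,
      mul_div_right_comm _ (q ^ n) b, mul_div_right_comm _ (q ^ n) (a * b),
      div_mul_div_comm]
    congr 1 <;> ring

/-- Telescoping identity for `watsonSum`, with `z` standing for `q^{-n}`. As the sum vanishes for odd
`n`, the recurrence has step two, hence `z / q / q` in the first summand. -/
theorem sum_watson_sub (q u v z : ℂ) (hq : q ≠ 0) (hz : z ≠ 0) (hu : QGeneric q u)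
    (hv : QGeneric q v) (h₁ : 1 - u / z ≠ 0) (h₂ : 1 - v * q / z ≠ 0) (h₃ : 1 - z / q ≠ 0)
    (K : ℕ) (hK : qShift q q K ≠ 0) :
    ∑ k ∈ range (K + 1), ((qShift q (z / q / q) k * qShift q (u / z * q) k * qShift (q ^ 2) v k) /
          (qShift q q k * qShift q v k * qShift (q ^ 2) u k) * q ^ k -
        (1 - q / z) * (v - u / z) / ((1 - u / z) * (1 - v * q / z)) *
        ((qShift q z k * qShift q (u / z / q) k * qShift (q ^ 2) v k) /
          (qShift q q k * qShift q v k * qShift (q ^ 2) u k) * q ^ k)) =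
      (1 - (1 - q / z) * (v - u / z) / ((1 - u / z) * (1 - v * q / z))) *
        ((qShift q (z / q) K * qShift q (u / z) K * qShift (q ^ 2) (v * q ^ 2) K) /
          (qShift q q K * qShift q v K * qShift (q ^ 2) u K)) := by
  induction K with
  | zero => simp [qShift_zero]
  | succ K ih =>
    rw [Finset.sum_range_succ, ih (qShift_ne_zero_of_le hK (Nat.le_succ K))]
    have f1 := qShift_ne_zero_of_le hK (Nat.le_succ K)
    have f2 := hv.qShift_ne_zero K
    have f3 := hu.base_sq.qShift_ne_zero K
    have g1 := one_sub_pow_ne_zero hK (Nat.lt_succ_self K)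
    have g2 := hv.one_sub_mul_pow_ne_zero K
    have g3 := hu.base_sq.one_sub_mul_pow_ne_zero K
    have e1 : qShift q (u / z * q) (K + 1) =
        qShift q (u / z) K * (1 - u / z * q ^ K) * (1 - u / z * (q ^ K * q)) / (1 - u / z) := by
      rw [eq_div_iff h₁, mul_comm, ← qShift_succ_left, qShift_succ, qShift_succ, pow_succ]
    have e2 : qShift q z (K + 1) =
        qShift q (z / q) K * (1 - z / q * q ^ K) * (1 - z / q * (q ^ K * q)) / (1 - z / q) := by
      rw [eq_div_iff h₃, mul_comm, ← pow_succ, ← qShift_succ, ← qShift_succ,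
        qShift_succ_left q (z / q), div_mul_cancel₀ _ hq]
    rw [e1, e2, qShift_succ_left q (z / q / q), div_mul_cancel₀ _ hq,
      qShift_succ_left q (u / z / q), div_mul_cancel₀ _ hq, qShift_succ_left (q ^ 2) v,
      qShift_succ q q, qShift_succ q v, qShift_succ (q ^ 2) u, qShift_succ q (z / q),
      qShift_succ q (u / z), qShift_succ (q ^ 2) (v * q ^ 2)]
    generalize qShift q (z / q) K = s1 at *
    generalize qShift q (u / z) K = s2 at *
    generalize qShift (q ^ 2) (v * q ^ 2) K = s3 at *
    generalize qShift q q K = s4 at *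
    generalize qShift q v K = s5 at *
    generalize qShift (q ^ 2) u K = s6 at *
    rw [← pow_mul, mul_comm 2 K, pow_mul] at *
    rw [pow_succ q K]
    generalize q ^ K = p at *
    clear ih e1 e2 hu hv hK
    have h1' : z - u ≠ 0 := by
      intro h; apply h₁; field_simp; linear_combination h
    have h2' : z - q * v ≠ 0 := by
      intro h; apply h₂; field_simp; linear_combination h
    have h3' : q - z ≠ 0 := by
      intro h; apply h₃; field_simp; linear_combination h
    field_simp
    ring

/-- The series of Andrews' terminating `q`-Watson formula,
`₄φ₃[q^{-n}, u q^{n-1}, √v, -√v; √u, -√u, v | q; q]`, with the parameters `±√u`, `±√v` merged into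
shifted factorials of base `q²` so that no square roots are needed. -/
noncomputable def watsonSum (q u v : ℂ) (n : ℕ) : ℂ :=
  ∑ k ∈ range (n + 1), (qShift q (q ^ (-n : ℤ)) k * qShift q (u * q ^ (n - 1 : ℤ)) k *
      qShift (q ^ 2) v k) / (qShift q q k * qShift q v k * qShift (q ^ 2) u k) * q ^ k

theorem watsonSum_add_two {q u v : ℂ} (hq : q ≠ 0) (hu : QGeneric q u) (hv : QGeneric q v) (n : ℕ)
    (hn : qShift q q (n + 2) ≠ 0) :
    watsonSum q u v (n + 2) = (1 - q * q ^ n) * (v - u * q ^ n) /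
      ((1 - u * q ^ n) * (1 - v * q * q ^ n)) * watsonSum q u v n := by
  have e1 : ∀ x : ℂ, x / q ^ (-n : ℤ) = x * q ^ n := fun x => by
    rw [zpow_neg, div_inv_eq_mul, zpow_natCast]
  have e2 : q ^ (-n : ℤ) / q / q = q ^ (-(n + 2 : ℕ) : ℤ) := by
    rw [show (-(n + 2 : ℕ) : ℤ) = -n - 1 - 1 by push_cast; ring, zpow_sub_one₀ hq,
      zpow_sub_one₀ hq, div_eq_mul_inv, div_eq_mul_inv]
  have e3 : u * q ^ n * q = u * q ^ ((n + 2 : ℕ) - 1 : ℤ) := by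
    rw [show ((n + 2 : ℕ) - 1 : ℤ) = n + 1 by push_cast; ring, zpow_add_one₀ hq, zpow_natCast,
      mul_assoc]
  have e4 : u * q ^ n / q = u * q ^ (n - 1 : ℤ) := by
    rw [zpow_sub_one₀ hq, zpow_natCast]; ring
  have e5 : q ^ (-n : ℤ) / q = q ^ (-(n + 1 : ℕ) : ℤ) := by
    rw [Nat.cast_succ, neg_add, ← sub_eq_add_neg, zpow_sub_one₀ hq, div_eq_mul_inv]
  have h₃ : 1 - q ^ (-n : ℤ) / q ≠ 0 := by
    have h := one_sub_pow_ne_zero hn (Nat.lt_succ_of_lt (Nat.lt_succ_self n))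
    intro h'
    apply h
    rw [e5, sub_eq_zero, zpow_neg, zpow_natCast, eq_comm, inv_eq_one] at h'
    rw [← pow_succ', h', sub_self]
  have key := sum_watson_sub q u v (q ^ (-n : ℤ)) hq (zpow_ne_zero _ hq) hu hv
    (e1 u ▸ hu.one_sub_mul_pow_ne_zero n)
    (e1 (v * q) ▸ (hv.shift hq 1 (by simp) : QGeneric q (v * q)).one_sub_mul_pow_ne_zero n) h₃
    (n + 2) hn
  rw [e2, e5, e1, e1, e1, e3, e4, qShift_zpow_neg_eq_zero hq (Nat.lt_succ_self (n + 1)), zero_mul,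
    zero_mul, zero_div, mul_zero, sum_sub_distrib, sub_eq_zero, ← mul_sum,
    sum_range_succ (n := n + 1 + 1), sum_range_succ (n := n + 1 + 1),
    sum_range_succ (n := n + 1), sum_range_succ (n := n + 1),
    qShift_zpow_neg_eq_zero hq (show n < n + 1 by omega),
    qShift_zpow_neg_eq_zero hq (show n < n + 1 + 1 by omega), zero_mul, zero_mul, zero_mul,
    zero_mul, zero_div, zero_mul, zero_div, zero_mul, add_zero, add_zero, ← sum_range_succ,
    ← sum_range_succ] at key
  exact key

/-- Andrews' terminating `q`-Watson formula, even case. -/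
theorem watsonSum_even {q u v : ℂ} (hq : q ≠ 0) (hv0 : v ≠ 0) (hu : QGeneric q u)
    (hv : QGeneric q v) (s : ℕ) (hs : qShift q q (2 * s) ≠ 0) :
    watsonSum q u v (2 * s) = v ^ s * (qShift (q ^ 2) q s * qShift (q ^ 2) (u / v) s /
      (qShift (q ^ 2) u s * qShift (q ^ 2) (v * q) s)) := by
  induction s with
  | zero => simp [watsonSum, qShift_zero]
  | succ s ih =>
    rw [mul_add_one] at hs ⊢
    rw [watsonSum_add_two hq hu hv _ hs,
      ih (qShift_ne_zero_of_le hs (by omega)), qShift_succ, qShift_succ, qShift_succ, qShift_succ,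
      pow_mul, pow_succ v s, show v - u * (q ^ 2) ^ s = v * (1 - u / v * (q ^ 2) ^ s) by
        field_simp, ← mul_div_assoc (v ^ s), ← mul_div_assoc (v ^ s * v), div_mul_div_comm]
    congr 1 <;> ring

/-- Andrews' terminating `q`-Watson formula, odd case. -/
theorem watsonSum_odd {q u v : ℂ} (hq : q ≠ 0) (hu : QGeneric q u)
    (hv : QGeneric q v) (s : ℕ) (hs : qShift q q (2 * s + 1) ≠ 0) :
    watsonSum q u v (2 * s + 1) = 0 := by
  induction s with
  | zero =>
    have h1 := hu.one_sub_ne_zero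
    have h2 := hv.one_sub_ne_zero
    have h3 : 1 - q ≠ 0 := by simpa using one_sub_pow_ne_zero hs Nat.one_pos
    simp only [watsonSum, mul_zero, zero_add, sum_range_succ, sum_range_zero, qShift_zero,
      qShift_one, Nat.cast_one, sub_self, zpow_zero, zpow_neg, zpow_one, mul_one, pow_one, pow_zero]
    field_simp
    ring
  | succ s ih =>
    rw [show 2 * (s + 1) + 1 = 2 * s + 1 + 2 by ring] at hs ⊢
    rw [watsonSum_add_two hq hu hv _ hs, ih (qShift_ne_zero_of_le hs (by omega)), mul_zero]

/-! ### Sears' transformation of balanced series -/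

theorem sum_range_triangle (f : ℕ → ℕ → ℂ) (n : ℕ) :
    ∑ k ∈ range (n + 1), ∑ j ∈ range (k + 1), f k j =
      ∑ j ∈ range (n + 1), ∑ r ∈ range (n - j + 1), f (j + r) j := by
  rw [Finset.sum_comm' (t' := range (n + 1)) (s' := fun j => Finset.Ico j (n + 1))
    (by intro x y; simp only [mem_range, mem_Ico]; omega)]
  refine sum_congr rfl fun j hj => ?_
  rw [Finset.sum_Ico_eq_sum_range, Nat.sub_add_comm (Nat.lt_succ_iff.1 (mem_range.1 hj))]

theorem sum_range_sum_range_sub (f : ℕ → ℕ → ℂ) (n : ℕ) :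
    ∑ j ∈ range (n + 1), ∑ r ∈ range (n - j + 1), f j r =
      ∑ k ∈ range (n + 1), ∑ j ∈ range (k + 1), f j (k - j) := by
  simp only [sum_range_triangle (fun k j => f j (k - j)), Nat.add_sub_cancel_left]

theorem choose_two_mul_two_add (j : ℕ) : j.choose 2 * 2 + j = j * j := by
  induction j with
  | zero => rfl
  | succ j ih =>
    rw [Nat.choose_succ_succ' j 1, Nat.choose_one_right]
    linarith

theorem pow_choose_two_sq (q : ℂ) (j : ℕ) : (q ^ j.choose 2) ^ 2 * q ^ j = q ^ (j * j) := by
  rw [← pow_mul, ← pow_add, choose_two_mul_two_add]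

theorem qShift_reverse_div {q x y : ℂ} (hq : q ≠ 0) (hx : x ≠ 0) (hy : y ≠ 0) {k j : ℕ}
    (hj : j ≤ k) (hxs : qShift q x k ≠ 0) (hys : qShift q y k ≠ 0) :
    qShift q (q ^ (1 - k : ℤ) / x) j / qShift q (q ^ (1 - k : ℤ) / y) j =
      qShift q x k * qShift q y (k - j) / (qShift q x (k - j) * qShift q y k) * (y / x) ^ j := by
  have hx' := qShift_ne_zero_of_le hxs (Nat.sub_le k j)
  have hy' := qShift_ne_zero_of_le hys (Nat.sub_le k j)
  have e : (-q / x) ^ j = (-q / y) ^ j * (y / x) ^ j := by rw [← mul_pow]; congr 1; field_simp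
  have hz : (-q / y) ^ j ≠ 0 := pow_ne_zero _ (div_ne_zero (neg_ne_zero.2 hq) hy)
  rw [eq_div_of_mul_eq hx' (qShift_reverse hq hx hj),
    eq_div_of_mul_eq hy' (qShift_reverse hq hy hj), e]
  generalize (-q / y) ^ j = t at *
  field_simp

/-- The `q`-Saalschütz sum in a form symmetric in the denominator parameters `c` and `d`; `b` enters
only through the balancing condition. -/
theorem sum_saalschutz_balanced {q a b c d : ℂ} (hq : q ≠ 0) (ha : a ≠ 0) (hb : b ≠ 0) (hc : c ≠ 0)
    (hd : d ≠ 0) (hcq : QGeneric q c) (hdq : QGeneric q d) (n : ℕ)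
    (h : c * d = a * b * q ^ (1 - n : ℤ)) (hn : qShift q q n ≠ 0) :
    ∑ k ∈ range (n + 1), (qShift q (q ^ (-n : ℤ)) k * qShift q a k * qShift q b k) /
        (qShift q q k * qShift q c k * qShift q d k) * q ^ k =
      qShift q (c / a) n * qShift q (d / a) n / (qShift q c n * qShift q d n) * a ^ n := by
  have hz : q ^ (1 - n : ℤ) ≠ 0 := zpow_ne_zero _ hq
  have e1 : a * b * q ^ (1 - n : ℤ) / c = d := by rw [← h]; field_simp
  have e2 : c / b = q ^ (1 - n : ℤ) / (d / a) := by field_simp; linear_combination h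
  have e3 : c / (a * b) = q ^ (1 - n : ℤ) / d := by field_simp; linear_combination h
  have key := sum_saalschutz hq ha hb hc hcq (hdq.shift hq (n - 1) (by
    rw [← e1, div_mul_eq_mul_div, mul_assoc (a * b), ← zpow_add₀ hq]
    simp)) n hn
  rw [e1, e2, e3] at key
  rw [key, mul_div_mul_comm]
  have r1 := qShift_reverse hq (div_ne_zero hd ha) (le_refl n)
  have r2 := qShift_reverse hq hd (le_refl n)
  rw [Nat.sub_self, qShift_zero, mul_one] at r1 r2
  have e : (-q / (d / a)) ^ n = (-q / d) ^ n * a ^ n := by rw [← mul_pow]; congr 1; field_simp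
  have hz' : (-q / d) ^ n ≠ 0 := pow_ne_zero _ (div_ne_zero (neg_ne_zero.2 hq) hd)
  rw [r1, r2, e]
  generalize (-q / d) ^ n = t at *
  have := hcq.qShift_ne_zero n
  have := hdq.qShift_ne_zero n
  field_simp

/-- The `q`-Saalschütz sum read as an expansion of `(B; q)_k (C; q)_k`, arranged as a convolution in
`k - j` and `j`. -/
theorem qShift_mul_eq_sum {q B C D : ℂ} (hq : q ≠ 0) (hB : B ≠ 0) (hC : C ≠ 0) (hD : D ≠ 0)
    (hDq : QGeneric q D) (hw : QGeneric q (B * C / D)) (k : ℕ) (hk : qShift q q k ≠ 0) :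
    qShift q B k * qShift q C k / (qShift q q k * qShift q D k) =
      ∑ j ∈ range (k + 1), qShift q (B * C / D) (k - j) / qShift q q (k - j) *
        ((B * C / D) ^ j * (qShift q (D / B) j * qShift q (D / C) j /
          (qShift q q j * qShift q D j))) := by
  have hw0 : B * C / D ≠ 0 := div_ne_zero (mul_ne_zero hB hC) hD
  have e1 : D / B * (D / C) / D = (B * C / D)⁻¹ := by field_simp
  have key := sum_saalschutz hq (div_ne_zero hD hB) (div_ne_zero hD hC) hD hDq
    (e1 ▸ hw.inv) k hk
  have e2 : D / (D / B) = B := by field_simp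
  have e3 : D / (D / C) = C := by field_simp
  have e4 : D / (D / B * (D / C)) = B * C / D := by field_simp
  have e5 : D / B * (D / C) * q ^ (1 - k : ℤ) / D = q ^ (1 - k : ℤ) / (B * C / D) := by field_simp
  have e6 : q ^ (-k : ℤ) = q ^ (1 - k : ℤ) / q := by
    rw [sub_eq_neg_add, zpow_add_one₀ hq, mul_div_cancel_right₀ _ hq]
  rw [e2, e3, e4, e5, e6] at key
  have hwk := hw.qShift_ne_zero k
  have hDk := hDq.qShift_ne_zero k
  rw [show qShift q B k * qShift q C k / (qShift q q k * qShift q D k) =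
    qShift q (B * C / D) k / qShift q q k *
      (qShift q B k * qShift q C k / (qShift q D k * qShift q (B * C / D) k)) by field_simp,
    ← key, mul_sum]
  refine sum_congr rfl fun j hj => ?_
  have hj' : j ≤ k := Nat.lt_succ_iff.1 (mem_range.1 hj)
  have r := qShift_reverse_div hq hq hw0 hj' hk hwk
  have h1 := qShift_ne_zero_of_le hk (Nat.sub_le k j)
  rw [show ∀ x y z u v w : ℂ, x * y * z / (u * v * w) = x / w * (y * z / (u * v)) by
    intros; rw [div_mul_div_comm]; ring, r, div_pow]
  field_simp

/-- Sears' transformation of terminating balanced `₄φ₃` series: one pair of numerator parameters is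
expanded by `qShift_mul_eq_sum`, and after interchanging the sums the inner one is balanced again. -/
theorem sears {q A B C D E F : ℂ} (hq : q ≠ 0) (hA : A ≠ 0) (hB : B ≠ 0) (hC : C ≠ 0)
    (hD : D ≠ 0) (hE : E ≠ 0) (hF : F ≠ 0) (hDq : QGeneric q D) (hEq : QGeneric q E)
    (hFq : QGeneric q F) (hw : QGeneric q (B * C / D)) (hEA : QGeneric q (E / A))
    (hFA : QGeneric q (F / A)) (n : ℕ) (bal : D * E * F = A * B * C * q ^ (1 - n : ℤ))
    (hn : qShift q q n ≠ 0) :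
    ∑ k ∈ range (n + 1), (qShift q (q ^ (-n : ℤ)) k * qShift q A k * qShift q B k *
        qShift q C k) / (qShift q q k * qShift q D k * qShift q E k * qShift q F k) * q ^ k =
      qShift q (E / A) n * qShift q (F / A) n / (qShift q E n * qShift q F n) * A ^ n *
      ∑ k ∈ range (n + 1), (qShift q (q ^ (-n : ℤ)) k * qShift q A k * qShift q (D / B) k *
        qShift q (D / C) k) / (qShift q q k * qShift q D k * qShift q (q ^ (1 - n : ℤ) / (E / A)) k *
          qShift q (q ^ (1 - n : ℤ) / (F / A)) k) * q ^ k := by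
  have hw0 : B * C / D ≠ 0 := div_ne_zero (mul_ne_zero hB hC) hD
  calc
    _ = ∑ k ∈ range (n + 1), ∑ j ∈ range (k + 1),
        (qShift q (q ^ (-n : ℤ)) k * qShift q A k) / (qShift q E k * qShift q F k) * q ^ k *
        (qShift q (B * C / D) (k - j) / qShift q q (k - j) *
        ((B * C / D) ^ j * (qShift q (D / B) j * qShift q (D / C) j /
          (qShift q q j * qShift q D j)))) := by
      refine sum_congr rfl fun k hk => ?_
      have hk' : k ≤ n := Nat.lt_succ_iff.1 (mem_range.1 hk)
      rw [← mul_sum, ← qShift_mul_eq_sum hq hB hC hD hDq hw k (qShift_ne_zero_of_le hn hk')]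
      simp only [div_eq_mul_inv, mul_inv]
      ring
    _ = _ := by
      rw [sum_range_triangle, mul_sum]
      refine sum_congr rfl fun j hj => ?_
      have hj' : j ≤ n := Nat.lt_succ_iff.1 (mem_range.1 hj)
      obtain ⟨N, rfl⟩ := Nat.exists_eq_add_of_le hj'
      have hqj : q ^ j ≠ 0 := pow_ne_zero _ hq
      have e0 : q ^ (-(j + N : ℕ) : ℤ) * q ^ j = q ^ (-N : ℤ) := by
        rw [← zpow_natCast, ← zpow_add₀ hq]; congr 1; push_cast; ring
      have e1 : E * q ^ j / (A * q ^ j) = E / A := by field_simp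
      have e2 : F * q ^ j / (A * q ^ j) = F / A := by field_simp
      have hEj : QGeneric q (E * q ^ j) := hEq.shift hq j (by simp)
      have hFj : QGeneric q (F * q ^ j) := hFq.shift hq j (by simp)
      have key := sum_saalschutz_balanced hq (mul_ne_zero hA hqj) hw0 (mul_ne_zero hE hqj)
        (mul_ne_zero hF hqj) hEj hFj N
        (by
          have : q ^ (1 - N : ℤ) = q ^ (1 - (j + N : ℕ) : ℤ) * q ^ j := by
            rw [← zpow_natCast, ← zpow_add₀ hq]; congr 1; push_cast; ring
          rw [this]
          field_simp
          linear_combination bal) (qShift_ne_zero_of_le hn (Nat.le_add_left N j))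
      rw [e1, e2] at key
      have r1 := qShift_reverse hq (div_ne_zero hE hA) hj'
      have r2 := qShift_reverse hq (div_ne_zero hF hA) hj'
      rw [Nat.add_sub_cancel_left] at r1 r2 ⊢
      have hs1 := hEA.qShift_ne_zero
      have hs2 := hFA.qShift_ne_zero
      have hs3 := hEq.qShift_ne_zero j
      have hs4 := hFq.qShift_ne_zero j
      have hs5 := hEj.qShift_ne_zero N
      have hs6 := hFj.qShift_ne_zero N
      have hs7 := hDq.qShift_ne_zero j
      have hs8 := qShift_ne_zero_of_le hn hj'
      calc _ = (qShift q (q ^ (-(j + N : ℕ) : ℤ)) j * qShift q A j * qShift q (D / B) j *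
          qShift q (D / C) j) / (qShift q q j * qShift q D j * (qShift q E j * qShift q F j)) *
          (B * C / D * q) ^ j * ∑ k ∈ range (N + 1), (qShift q (q ^ (-N : ℤ)) k *
            qShift q (A * q ^ j) k * qShift q (B * C / D) k) / (qShift q q k *
              qShift q (E * q ^ j) k * qShift q (F * q ^ j) k) * q ^ k := by
            rw [mul_sum]
            refine sum_congr rfl fun r _ => ?_
            rw [Nat.add_sub_cancel_left, qShift_add, qShift_add, qShift_add, qShift_add, e0,
              pow_add, mul_pow]
            simp only [div_eq_mul_inv, mul_inv]
            ring
        _ = _ := by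
            rw [key, qShift_add q E, qShift_add q F]
            have hB' : B * C / D = E * F * q ^ (j + N) / (A * q) := by
              rw [zpow_sub₀ hq, zpow_one, zpow_natCast] at bal
              have := pow_ne_zero (j + N) hq
              field_simp at bal ⊢
              linear_combination -bal
            -- The monomials produced by the two reversals leave exactly the argument `q` of the new series.
            have hm : A ^ (j + N) * q ^ j = ((-q / (E / A)) ^ j * (q ^ j.choose 2 /
                q ^ ((j + N) * j))) * ((-q / (F / A)) ^ j * (q ^ j.choose 2 / q ^ ((j + N) * j))) *
                (B * C / D * q) ^ j * (A * q ^ j) ^ N := by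
              have h1 : (-q / (E / A)) ^ j * (-q / (F / A)) ^ j * (B * C / D * q) ^ j =
                  A ^ j * q ^ j * q ^ j * q ^ ((j + N) * j) := by
                rw [hB', pow_mul, ← mul_pow, ← mul_pow, ← mul_pow, ← mul_pow, ← mul_pow]
                congr 1
                field_simp
              have h2 := pow_choose_two_sq q j
              have h3 : q ^ ((j + N) * j) = q ^ (j * j) * (q ^ j) ^ N := by ring
              calc _ = A ^ j * q ^ j * A ^ N := by ring
                _ = A ^ j * q ^ j * q ^ j * q ^ ((j + N) * j) * (q ^ j.choose 2) ^ 2 /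
                    (q ^ ((j + N) * j)) ^ 2 * (A ^ N * (q ^ j) ^ N) := by
                  rw [h3, ← h2]
                  field_simp
                _ = _ := by
                  rw [← h1, mul_pow A]
                  ring
            have hm1 : (-q / (E / A)) ^ j * (q ^ j.choose 2 / q ^ ((j + N) * j)) ≠ 0 := by
              simp [hq, hE, hA]
            have hm2 : (-q / (F / A)) ^ j * (q ^ j.choose 2 / q ^ ((j + N) * j)) ≠ 0 := by
              simp [hq, hF, hA]
            rw [eq_div_of_mul_eq (hs1 N) r1, eq_div_of_mul_eq (hs2 N) r2]
            generalize (-q / (E / A)) ^ j * (q ^ j.choose 2 / q ^ ((j + N) * j)) = m1 at *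
            generalize (-q / (F / A)) ^ j * (q ^ j.choose 2 / q ^ ((j + N) * j)) = m2 at *
            have hs9 := hs1 N
            have hs10 := hs2 N
            have hs11 := hs1 (j + N)
            have hs12 := hs2 (j + N)
            clear hs1 hs2 r1 r2 key e1 e2 hB'
            generalize (B * C / D * q) ^ j = x1 at *
            generalize (A * q ^ j) ^ N = x2 at *
            generalize A ^ (j + N) = x3 at *
            field_simp
            linear_combination (-(qShift q (q ^ (-(j + N : ℕ) : ℤ)) j * qShift q A j *
              qShift q (D / B) j * qShift q (D / C) j)) * hm

/-! ### Linearization of the two integer shifts -/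

/-- The `₆φ₅` sum with `A = x²/q`, `B = 1/y`, `C = x`, for which the factors containing `C` cancel.
The right-hand side is the ratio of `(x y; q)_N / (x² y; q)_N` to its value at `y = 1`. -/
theorem sum_linearization {q x y : ℂ} (hq : q ≠ 0) (hx : x ≠ 0) (hy : y ≠ 0)
    (hxq : QGeneric q (x ^ 2)) (hxy : QGeneric q (x ^ 2 * y)) (N : ℕ) (hN : qShift q q N ≠ 0) :
    ∑ i ∈ range (N + 1), (1 - q⁻¹ * x ^ 2 * q ^ (2 * i)) / (1 - q⁻¹ * x ^ 2) *
        (qShift q (q⁻¹ * x ^ 2) i * qShift q y⁻¹ i * qShift q (q ^ (-N : ℤ)) i) /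
        (qShift q q i * qShift q (x ^ 2 * y) i * qShift q (x ^ 2 * q ^ N) i) *
          (x * y * q ^ N) ^ i =
      qShift q (x ^ 2) N * qShift q (x * y) N / (qShift q (x ^ 2 * y) N * qShift q x N) := by
  have e1 : q⁻¹ * x ^ 2 * q = x ^ 2 := by field_simp
  have e3 : x ^ 2 / y⁻¹ = x ^ 2 * y := div_inv_eq_mul _ _
  have e4 : x ^ 2 / x = x := by field_simp
  have e5 : ∀ N : ℕ, x ^ 2 * q ^ N / (y⁻¹ * x) = x * y * q ^ N := fun N => by field_simp
  have e6 : x ^ 2 / (y⁻¹ * x) = x * y := by field_simp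
  have key := sum_wellPoised (A := q⁻¹ * x ^ 2) hq (inv_ne_zero hy) hx
    (hxq.shift hq (-1) (by rw [zpow_neg_one, mul_comm]))
    (hxy.shift hq (-1) (by rw [zpow_neg_one, div_inv_eq_mul]; ring))
    (hxq.of_sq.shift hq (-1) (by rw [zpow_neg_one]; field_simp)) N hN
  rw [e1, e3, e4, e6] at key
  rw [← key]
  refine sum_congr rfl fun i _ => ?_
  have h := hxq.of_sq.qShift_ne_zero i
  rw [e5]
  field_simp

/-- The series
`₄φ₃[q^{-n}, c, -yc, q^{1-n}/(xa²); q^{1-n}/(xa), -q^{1-n}/a, yc² | q; q]` that arises from the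
left-hand side by Sears' transformation; there `x = q^ℓ` and `y = q^m`. -/
noncomputable def whippleSum (q a c x y : ℂ) (n : ℕ) : ℂ :=
  ∑ k ∈ range (n + 1), (qShift q (q ^ (-n : ℤ)) k * qShift q c k * qShift q (-(y * c)) k *
      qShift q (q ^ (1 - n : ℤ) / (x * a ^ 2)) k) /
    (qShift q q k * qShift q (q ^ (1 - n : ℤ) / (x * a)) k * qShift q (-(q ^ (1 - n : ℤ) / a)) k *
      qShift q (y * c ^ 2) k) * q ^ k

/-- Removal of `x`: the quotient of the two factors of the `k`-th term that contain `x` is expanded by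
`sum_linearization` with `N = n - k`. -/
theorem whippleSum_eq_sum_whippleSum_one {q a c x y : ℂ} (hq : q ≠ 0) (ha : a ≠ 0) (hx : x ≠ 0)
    (haq : QGeneric q (a ^ 2)) (hxa : QGeneric q (x * a)) (hxa2 : QGeneric q (x * a ^ 2))
    (n : ℕ) (hn : qShift q q n ≠ 0) :
    whippleSum q a c x y n = qShift q (x * a ^ 2) n * qShift q a n /
        (qShift q (a ^ 2) n * qShift q (x * a) n) *
      ∑ i ∈ range (n + 1), (1 - q⁻¹ * a ^ 2 * q ^ (2 * i)) / (1 - q⁻¹ * a ^ 2) *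
        (qShift q (q⁻¹ * a ^ 2) i * qShift q x⁻¹ i * qShift q (q ^ (-n : ℤ)) i) /
        (qShift q q i * qShift q (x * a ^ 2) i * qShift q (q ^ n * a ^ 2) i) *
          (x * a * q ^ n) ^ i * whippleSum q (q ^ i * a) c 1 y (n - i) := by
  have ha2 : a ^ 2 ≠ 0 := pow_ne_zero _ ha
  simp only [whippleSum, mul_sum]
  rw [Finset.sum_comm' (t' := range (n + 1)) (s' := fun k => range (n - k + 1))
    (by intro i k; simp only [mem_range]; omega)]
  refine sum_congr rfl fun k hk => ?_
  have hk' : k ≤ n := Nat.lt_succ_iff.1 (mem_range.1 hk)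
  have V := sum_linearization hq ha hx haq (mul_comm x _ ▸ hxa2) (n - k)
    (qShift_ne_zero_of_le hn (Nat.sub_le n k))
  have s1 := haq.qShift_ne_zero
  have s2 := haq.of_sq.qShift_ne_zero
  have s3 := hxa.qShift_ne_zero
  have s4 := hxa2.qShift_ne_zero
  have R := qShift_reverse_div hq (mul_ne_zero hx ha2) (mul_ne_zero hx ha) hk' (s4 n) (s3 n)
  rw [mul_comm (a ^ 2) x, mul_comm a x] at V
  have R' : qShift q (q ^ (1 - n : ℤ) / (x * a ^ 2)) k / qShift q (q ^ (1 - n : ℤ) / (x * a)) k =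
      qShift q (x * a ^ 2) n * qShift q a n / (qShift q (a ^ 2) n * qShift q (x * a) n) *
      (qShift q (a ^ 2) n * qShift q a (n - k) / (qShift q a n * qShift q (a ^ 2) (n - k)) *
        (a ^ k)⁻¹ * (qShift q (a ^ 2) (n - k) * qShift q (x * a) (n - k) /
          (qShift q (x * a ^ 2) (n - k) * qShift q a (n - k)))) := by
    have e : x * a / (x * a ^ 2) = a⁻¹ := by field_simp
    rw [R, e, inv_pow]
    have := s1 n
    have := s2 n
    have := s3 n
    have := s4 n
    have := s1 (n - k)
    have := s2 (n - k)
    have := s3 (n - k)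
    have := s4 (n - k)
    field_simp
  calc _ = qShift q (q ^ (1 - n : ℤ) / (x * a ^ 2)) k / qShift q (q ^ (1 - n : ℤ) / (x * a)) k *
      (qShift q (q ^ (-n : ℤ)) k * qShift q c k * qShift q (-(y * c)) k / (qShift q q k *
        qShift q (-(q ^ (1 - n : ℤ) / a)) k * qShift q (y * c ^ 2) k) * q ^ k) := by
        simp only [div_eq_mul_inv, mul_inv]
        ring
    _ = _ := by
      rw [R', ← V, mul_sum, mul_sum, sum_mul]
      refine sum_congr rfl fun i hi => ?_
      obtain ⟨d, rfl⟩ : ∃ d, n = k + i + d := Nat.exists_eq_add_of_le (by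
        have := mem_range.1 hi
        omega)
      have e1 : k + i + d - k = i + d := by omega
      have e2 : k + i + d - i = k + d := by omega
      rw [e1, e2]
      have hqi : q ^ i ≠ 0 := pow_ne_zero _ hq
      have z1 : q ^ (1 - (k + d : ℕ) : ℤ) = q ^ (1 - (k + i + d : ℕ) : ℤ) * q ^ i := by
        rw [← zpow_natCast q i, ← zpow_add₀ hq]; congr 1; push_cast; ring
      have z2 : q ^ (1 - (k + i + d : ℕ) : ℤ) = q ^ (1 - (k + i + d + i : ℕ) : ℤ) * q ^ i := by
        rw [← zpow_natCast q i, ← zpow_add₀ hq]; congr 1; push_cast; ring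
      have e3 : q ^ (1 - (k + d : ℕ) : ℤ) / (q ^ i * a) = q ^ (1 - (k + i + d : ℕ) : ℤ) / a := by
        rw [z1]; field_simp
      have e4 : q ^ (1 - (k + d : ℕ) : ℤ) / (1 * (q ^ i * a) ^ 2) =
          q ^ (1 - (k + i + d + i : ℕ) : ℤ) / a ^ 2 := by
        rw [z1, z2]; field_simp
      rw [e4, one_mul, e3]
      -- Both sides are `(q^{-n}; q)_{k+i}`.
      have P : qShift q (q ^ (-(k + i + d : ℕ) : ℤ)) k * qShift q (q ^ (-(i + d : ℕ) : ℤ)) i =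
          qShift q (q ^ (-(k + i + d : ℕ) : ℤ)) i * qShift q (q ^ (-(k + d : ℕ) : ℤ)) k := by
        have z3 : q ^ (-(i + d : ℕ) : ℤ) = q ^ (-(k + i + d : ℕ) : ℤ) * q ^ k := by
          rw [← zpow_natCast q k, ← zpow_add₀ hq]; congr 1; push_cast; ring
        have z4 : q ^ (-(k + d : ℕ) : ℤ) = q ^ (-(k + i + d : ℕ) : ℤ) * q ^ i := by
          rw [← zpow_natCast q i, ← zpow_add₀ hq]; congr 1; push_cast; ring
        rw [z3, z4, ← qShift_add, ← qShift_add, add_comm k i]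
      have Q : qShift q (a ^ 2) (k + i + d) * qShift q a (i + d) / (qShift q a (k + i + d) *
          qShift q (a ^ 2) (i + d) * qShift q (a ^ 2 * q ^ (i + d)) i) * (a ^ k)⁻¹ *
            (x * a * q ^ (i + d)) ^ i =
          qShift q (q ^ (1 - (k + i + d + i : ℕ) : ℤ) / a ^ 2) k /
            (qShift q (q ^ (k + i + d) * a ^ 2) i *
              qShift q (q ^ (1 - (k + i + d : ℕ) : ℤ) / a) k) *
            (x * a * q ^ (k + i + d)) ^ i := by
        have r1 := qShift_reverse hq ha2 (show k ≤ k + i + d + i by omega)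
        have r2 := qShift_reverse hq ha (show k ≤ k + i + d by omega)
        rw [show k + i + d + i - k = i + d + i by omega, qShift_add q (a ^ 2) (k + i + d) i,
          mul_comm (a ^ 2) (q ^ _)] at r1
        rw [e1] at r2
        have hG : qShift q (q ^ (k + i + d) * a ^ 2) i ≠ 0 :=
          (haq.shift hq (k + i + d : ℕ) (by rw [zpow_natCast, mul_comm])).qShift_ne_zero i
        have m : (-q / a ^ 2) ^ k * (q ^ k.choose 2 / q ^ ((k + i + d + i) * k)) * q ^ (k * i) =
            (-q / a) ^ k * (q ^ k.choose 2 / q ^ ((k + i + d) * k)) * (a ^ k)⁻¹ := by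
          have : (-q / a) ^ k = (-q / a ^ 2) ^ k * a ^ k := by
            rw [← mul_pow]; congr 1; field_simp
          rw [this]
          have h := pow_ne_zero k ha
          have h' : q ^ ((k + i + d + i) * k) = q ^ ((k + i + d) * k) * q ^ (k * i) := by
            rw [← pow_add]; congr 1; ring
          rw [h']
          field_simp
        have hm : (-q / a) ^ k * (q ^ k.choose 2 / q ^ ((k + i + d) * k)) ≠ 0 := by
          simp [hq, ha]
        have hx : (x * a * q ^ (k + i + d)) ^ i = (x * a * q ^ (i + d)) ^ i * q ^ (k * i) := by
          rw [pow_mul, ← mul_pow]; congr 1; ring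
        rw [hx, mul_assoc (qShift q a (k + i + d)), ← qShift_add,
          eq_div_of_mul_eq (s1 _) r1, eq_div_of_mul_eq (s2 _) r2]
        generalize (-q / a) ^ k * (q ^ k.choose 2 / q ^ ((k + i + d) * k)) = m2 at *
        generalize (-q / a ^ 2) ^ k * (q ^ k.choose 2 / q ^ ((k + i + d + i) * k)) = m1 at *
        have t1 := s1 (k + i + d)
        have t2 := s1 (i + d + i)
        have t3 := s2 (k + i + d)
        have t4 := s2 (i + d)
        generalize q ^ (k * i) = w at *
        generalize (x * a * q ^ (i + d)) ^ i = w' at *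
        have m' : m1 * w / m2 = (a ^ k)⁻¹ := by rw [m]; field_simp
        rw [← m']
        generalize qShift q (q ^ (k + i + d) * a ^ 2) i = g at *
        field_simp
      generalize qShift q (x * a ^ 2) (k + i + d) * qShift q a (k + i + d) /
        (qShift q (a ^ 2) (k + i + d) * qShift q (x * a) (k + i + d)) = p
      calc _ = p * ((1 - q⁻¹ * a ^ 2 * q ^ (2 * i)) / (1 - q⁻¹ * a ^ 2) *
          (qShift q (q⁻¹ * a ^ 2) i * qShift q x⁻¹ i * qShift q c k * qShift q (-(y * c)) k) /
          (qShift q q i * qShift q (x * a ^ 2) i * qShift q q k *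
            qShift q (-(q ^ (1 - (k + i + d : ℕ) : ℤ) / a)) k * qShift q (y * c ^ 2) k) * q ^ k) *
            (qShift q (q ^ (-(k + i + d : ℕ) : ℤ)) k * qShift q (q ^ (-(i + d : ℕ) : ℤ)) i) *
          (qShift q (a ^ 2) (k + i + d) * qShift q a (i + d) / (qShift q a (k + i + d) *
          qShift q (a ^ 2) (i + d) * qShift q (a ^ 2 * q ^ (i + d)) i) * (a ^ k)⁻¹ *
            (x * a * q ^ (i + d)) ^ i) := by
            simp only [div_eq_mul_inv, mul_inv]
            ring
        _ = _ := by
            rw [P, Q]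
            simp only [div_eq_mul_inv, mul_inv]
            ring

/-- Removal of `y`: the quotient of the two factors of the `k`-th term that contain `y` is expanded by
`sum_linearization` at `x = -c` with `N = k`, and the index is shifted from `k` to `k - j`. -/
theorem whippleSum_one_eq_sum_watsonSum {q a c y : ℂ} (hq : q ≠ 0) (hc : c ≠ 0)
    (hy : y ≠ 0) (hcq : QGeneric q (c ^ 2)) (hyc : QGeneric q (y * c ^ 2))
    (n : ℕ) (hn : qShift q q n ≠ 0) :
    whippleSum q a c 1 y n = ∑ j ∈ range (n + 1), c ^ j * y ^ j * q ^ (j.choose 2 + j) *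
        ((qShift q y⁻¹ j * qShift q (q ^ (-n : ℤ)) j * qShift q (q ^ (1 - n : ℤ) / a ^ 2) j *
          qShift q c j * qShift q (-c) j) /
        (qShift q q j * qShift q (q ^ (1 - n : ℤ) / a) j * qShift q (-(q ^ (1 - n : ℤ) / a)) j *
          qShift q (y * c ^ 2) j * qShift q (q ^ (j - 1 : ℤ) * c ^ 2) j)) *
        watsonSum q ((q ^ (1 - n : ℤ) / a * q ^ j) ^ 2) ((c * q ^ j) ^ 2) (n - j) := by
  simp only [whippleSum, watsonSum, mul_sum, one_mul]
  rw [sum_range_sum_range_sub]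
  refine sum_congr rfl fun k hk => ?_
  have hk' : k ≤ n := Nat.lt_succ_iff.1 (mem_range.1 hk)
  have hkq := qShift_ne_zero_of_le hn hk'
  have V := sum_linearization hq (neg_ne_zero.2 hc) hy (by rwa [neg_sq])
    (by rwa [neg_sq, mul_comm]) k hkq
  have s1 := hcq.qShift_ne_zero
  have s2 := hcq.neg_of_sq.qShift_ne_zero
  have s3 := hyc.qShift_ne_zero
  rw [neg_sq, mul_comm (c ^ 2) y, mul_comm (-c) y, mul_neg] at V
  have R : qShift q (-(y * c)) k / qShift q (y * c ^ 2) k = qShift q (-c) k / qShift q (c ^ 2) k *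
      (qShift q (c ^ 2) k * qShift q (-(y * c)) k / (qShift q (y * c ^ 2) k * qShift q (-c) k)) := by
    have := s1 k
    have := s2 k
    have := s3 k
    field_simp
  calc _ = qShift q (-(y * c)) k / qShift q (y * c ^ 2) k * (qShift q (q ^ (-n : ℤ)) k *
      qShift q c k * qShift q (q ^ (1 - n : ℤ) / a ^ 2) k / (qShift q q k *
        qShift q (q ^ (1 - n : ℤ) / a) k * qShift q (-(q ^ (1 - n : ℤ) / a)) k) * q ^ k) := by
        simp only [div_eq_mul_inv, mul_inv]
        ring
    _ = _ := by
      rw [R, ← V, mul_sum, sum_mul]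
      refine sum_congr rfl fun j hj => ?_
      obtain ⟨r, rfl⟩ := Nat.exists_eq_add_of_le (Nat.lt_succ_iff.1 (mem_range.1 hj))
      obtain ⟨d, rfl⟩ := Nat.exists_eq_add_of_le hk'
      have hqj : q ^ j ≠ 0 := pow_ne_zero _ hq
      have e1 : j + r + d - j = r + d := by omega
      have hr := qShift_ne_zero_of_le hkq (Nat.le_add_left r j)
      rw [e1, Nat.add_sub_cancel_left]
      have F1 : qShift q (q ^ (-(j + r : ℕ) : ℤ)) j / qShift q q (j + r) *
          (-(y * c) * q ^ (j + r)) ^ j = c ^ j * y ^ j * q ^ j.choose 2 / qShift q q r := by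
        have h := qShift_reverse hq hq (Nat.le_add_right j r)
        rw [Nat.add_sub_cancel_left, show q ^ (1 - (j + r : ℕ) : ℤ) / q = q ^ (-(j + r : ℕ) : ℤ) by
          rw [sub_eq_neg_add, zpow_add_one₀ hq, mul_div_cancel_right₀ _ hq]] at h
        rw [eq_div_of_mul_eq hr h, mul_pow, ← pow_mul]
        have h' : (-q / q) ^ j * (-(y * c)) ^ j = c ^ j * y ^ j := by
          rw [← mul_pow, ← mul_pow]; congr 1; field_simp
        rw [← h']
        have := pow_ne_zero ((j + r) * j) hq
        field_simp
      -- Both sides come from splitting `(c²/q; q)_{2j+1}` in two ways.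
      have F2 : (1 - q⁻¹ * c ^ 2 * q ^ (2 * j)) / (1 - q⁻¹ * c ^ 2) * qShift q (q⁻¹ * c ^ 2) j /
          (qShift q (c ^ 2) (j + r) * qShift q (c ^ 2 * q ^ (j + r)) j) =
          1 / (qShift q (q ^ (j - 1 : ℤ) * c ^ 2) j * qShift q ((c * q ^ j) ^ 2) r) := by
        have g : QGeneric q (q⁻¹ * c ^ 2) := hcq.shift hq (-1) (by rw [zpow_neg_one, mul_comm])
        have g1 := g.one_sub_ne_zero
        have h1 : qShift q (q⁻¹ * c ^ 2) (2 * j + 1) =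
            (1 - q⁻¹ * c ^ 2) * qShift q (c ^ 2) (2 * j) := by
          rw [qShift_succ_left]; congr 2; field_simp
        have h2 : qShift q (q⁻¹ * c ^ 2) (2 * j + 1) = qShift q (q⁻¹ * c ^ 2) j *
            qShift q (q ^ (j - 1 : ℤ) * c ^ 2) j * (1 - q⁻¹ * c ^ 2 * q ^ (2 * j)) := by
          rw [qShift_succ, two_mul, qShift_add, zpow_sub_one₀ hq, zpow_natCast]
          congr 3; ring
        have h3 : qShift q (c ^ 2) (2 * j + r) =
            qShift q (c ^ 2) (2 * j) * qShift q ((c * q ^ j) ^ 2) r := by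
          rw [qShift_add]; congr 2; ring
        have t0 := s1 (2 * j + r)
        have t1 : qShift q (q ^ (j - 1 : ℤ) * c ^ 2) j ≠ 0 :=
          (hcq.shift hq (j - 1) (mul_comm _ _)).qShift_ne_zero j
        rw [← qShift_add, show j + r + j = 2 * j + r by ring]
        rw [h3] at t0 ⊢
        have t2 := left_ne_zero_of_mul t0
        have t3 := right_ne_zero_of_mul t0
        rw [h1] at h2
        generalize qShift q (q⁻¹ * c ^ 2) j = x1 at *
        generalize qShift q (q ^ (j - 1 : ℤ) * c ^ 2) j = x2 at *
        generalize 1 - q⁻¹ * c ^ 2 * q ^ (2 * j) = x3 at *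
        generalize 1 - q⁻¹ * c ^ 2 = x4 at *
        generalize qShift q ((c * q ^ j) ^ 2) r = x5 at *
        field_simp
        linear_combination -h2
      have e2 : (q ^ (1 - (j + r + d : ℕ) : ℤ) / a * q ^ j) ^ 2 * q ^ ((r + d : ℕ) - 1 : ℤ) =
          q ^ (1 - (j + r + d : ℕ) : ℤ) / a ^ 2 * q ^ j := by
        have : q ^ ((r + d : ℕ) - 1 : ℤ) * (q ^ (1 - (j + r + d : ℕ) : ℤ) * q ^ j) = 1 := by
          rw [← zpow_natCast q j, ← zpow_add₀ hq, ← zpow_add₀ hq, ← zpow_zero q]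
          congr 1; push_cast; ring
        rw [← mul_one (_ / a ^ 2 * q ^ j), ← this]
        ring
      have e3 : q ^ (-(r + d : ℕ) : ℤ) = q ^ (-(j + r + d : ℕ) : ℤ) * q ^ j := by
        rw [← zpow_natCast q j, ← zpow_add₀ hq]; congr 1; push_cast; ring
      rw [e2, e3, ← qShift_mul_neg, ← qShift_mul_neg]
      generalize q ^ (1 - (j + r + d : ℕ) : ℤ) / a ^ 2 = f
      generalize q ^ (1 - (j + r + d : ℕ) : ℤ) / a = e
      generalize q ^ (-(j + r + d : ℕ) : ℤ) = z
      calc _ = (qShift q y⁻¹ j * qShift q z (j + r) * qShift q f (j + r) * qShift q c (j + r) *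
            qShift q (-c) (j + r)) / (qShift q q j * qShift q e (j + r) * qShift q (-e) (j + r) *
              qShift q (y * c ^ 2) j) * q ^ (j + r) *
            ((1 - q⁻¹ * c ^ 2 * q ^ (2 * j)) / (1 - q⁻¹ * c ^ 2) * qShift q (q⁻¹ * c ^ 2) j /
              (qShift q (c ^ 2) (j + r) * qShift q (c ^ 2 * q ^ (j + r)) j)) *
            (qShift q (q ^ (-(j + r : ℕ) : ℤ)) j / qShift q q (j + r) *
              (-(y * c) * q ^ (j + r)) ^ j) := by
            simp only [div_eq_mul_inv, mul_inv]
            ring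
        _ = _ := by
            rw [F1, F2]
            simp only [qShift_add, pow_add, neg_mul]
            simp only [div_eq_mul_inv, mul_inv]
            ring

/-! ### The two sides as functions of the parameters -/

/-- The terminating series on the left, summed over `k ≤ n`. -/
noncomputable def leftSum (q : ℂ) (n ℓ m : ℕ) (a c : ℂ) : ℂ :=
  ∑ k ∈ range (n + 1), qFrac q [q ^ (-n : ℤ), a, c, -(q ^ (1 - ℓ - m - n : ℤ) / (a * c))]
    [q, q ^ (1 - ℓ - n : ℤ) / a, q ^ (1 - m - n : ℤ) / c, -(a * c)] k * q ^ k

/-- The summand with indices `i`, `j` of the double sum on the right. The index `(n - i - j) / 2` is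
computed in `ℕ`; it is only relevant if `n - i - j` is nonnegative and even. -/
noncomputable def rightTerm (q : ℂ) (n ℓ m i j : ℕ) (a c : ℂ) : ℂ :=
  q ^ ((ℓ + n) * i + (m + n - i) * j - (j.choose 2 : ℕ) : ℤ) *
        a ^ i * c ^ (n - i : ℤ) *
        ((1 - q ^ (2 * i - 1 : ℤ) * a ^ 2) / (1 - q ^ (-1 : ℤ) * a ^ 2)) *
        qFrac q
          [q ^ (-ℓ : ℤ), q ^ (-n : ℤ), q ^ (-1 : ℤ) * a ^ 2]
          [q, q ^ n * a ^ 2, q ^ ℓ * a ^ 2] i *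
        qFrac q
          [q ^ (-m : ℤ), q ^ (i - n : ℤ), q ^ (1 - n - i : ℤ) / a ^ 2, c, -c]
          [q, q ^ (1 - n : ℤ) / a, -(q ^ (1 - n : ℤ) / a), q ^ m * c ^ 2,
            q ^ (j - 1 : ℤ) * c ^ 2] j *
        qFrac (q ^ 2)
          [q, q ^ (2 - 2 * n : ℤ) / (a ^ 2 * c ^ 2)]
          [q ^ (2 - 2 * n + 2 * j : ℤ) / a ^ 2, q ^ (1 + 2 * j) * c ^ 2]
          ((n - i - j) / 2) *
        parityChi (n - i - j : ℤ)

/-- The right-hand side, prefactors included. -/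
noncomputable def rightSum (q : ℂ) (n ℓ m : ℕ) (a c : ℂ) : ℂ :=
  qFrac q [a, q ^ n * a ^ 2] [a ^ 2, q ^ n * a] ℓ *
    qFrac q [-a, q ^ m * c ^ 2] [-(a * c), q ^ m * c] n *
      ∑ i ∈ range (ℓ + 1), ∑ j ∈ range (m + 1), rightTerm q n ℓ m i j a c

theorem qFrac_eq_zero {q x : ℂ} {num : List ℂ} (den : List ℂ) {k : ℕ} (hx : x ∈ num)
    (h : qShift q x k = 0) : qFrac q num den k = 0 := by
  rw [qFrac, List.prod_eq_zero (List.mem_map.2 ⟨x, hx, h⟩), zero_div]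

theorem basicHyp_eq_leftSum {q : ℂ} (hq : q ≠ 0) (n ℓ m : ℕ) (a c : ℂ) :
    basicHyp q q [q ^ (-n : ℤ), a, c, -(q ^ (1 - ℓ - m - n : ℤ) / (a * c))]
        [q ^ (1 - ℓ - n : ℤ) / a, q ^ (1 - m - n : ℤ) / c, -(a * c)] = leftSum q n ℓ m a c := by
  refine tsum_eq_sum fun k hk => ?_
  have hk' : n < k := by simpa [Nat.lt_succ_iff] using hk
  rw [qFrac_eq_zero _ List.mem_cons_self (qShift_zpow_neg_eq_zero hq hk'), zero_mul]

theorem parityChi_even (s : ℕ) : parityChi (2 * s : ℕ) = 1 := by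
  rw [parityChi, zpow_natCast, pow_mul]
  norm_num

theorem parityChi_odd (s : ℕ) : parityChi (2 * s + 1 : ℕ) = 0 := by
  rw [parityChi, zpow_natCast, pow_succ, pow_mul]
  simp

/-- The summands outside the ranges of summation, with `i + j > n`, or with `n - i - j` odd vanish
identically, whatever the denominators are. -/
theorem rightTerm_eq_zero {q : ℂ} (hq : q ≠ 0) {n ℓ m i j : ℕ} (a c : ℂ)
    (h : ℓ < i ∨ m < j ∨ n < i + j ∨ ∃ s, i + j + (2 * s + 1) = n) :
    rightTerm q n ℓ m i j a c = 0 := by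
  rcases h with h | h | h | ⟨s, rfl⟩
  · simp only [rightTerm, qFrac_eq_zero [q, q ^ n * a ^ 2, q ^ ℓ * a ^ 2] List.mem_cons_self
      (qShift_zpow_neg_eq_zero hq h), mul_zero, zero_mul]
  · simp only [rightTerm, qFrac_eq_zero (q := q) (x := q ^ (-m : ℤ)) _ List.mem_cons_self
      (qShift_zpow_neg_eq_zero hq h), mul_zero, zero_mul]
  · rcases lt_or_ge n i with hi | hi
    · simp only [rightTerm, qFrac_eq_zero [q, q ^ n * a ^ 2, q ^ ℓ * a ^ 2]
        (List.mem_cons_of_mem _ List.mem_cons_self) (qShift_zpow_neg_eq_zero hq hi), mul_zero,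
        zero_mul]
    · have h0 := qShift_zpow_neg_eq_zero hq (show n - i < j by omega)
      rw [Nat.cast_sub hi, neg_sub] at h0
      simp only [rightTerm, qFrac_eq_zero (q := q) (x := q ^ (i - n : ℤ)) _
        (List.mem_cons_of_mem _ List.mem_cons_self) h0, mul_zero, zero_mul]
  · have : ((i + j + (2 * s + 1) : ℕ) - i - j : ℤ) = (2 * s + 1 : ℕ) := by push_cast; ring
    rw [rightTerm, this, parityChi_odd, mul_zero]

theorem sum_range_succ_eq_of_eq_zero {f : ℕ → ℂ} {m n : ℕ} (hm : ∀ i, m < i → f i = 0)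
    (hn : ∀ i, n < i → f i = 0) : ∑ i ∈ range (m + 1), f i = ∑ i ∈ range (n + 1), f i := by
  rw [← Finset.sum_subset (s₁ := range (min m n + 1)) (range_subset_range.2 (by omega)),
    ← Finset.sum_subset (s₁ := range (min m n + 1)) (s₂ := range (n + 1))
      (range_subset_range.2 (by omega))]
  · intro i _ hi
    rw [mem_range] at hi
    rcases le_total m n with h | h
    · exact hm i (by omega)
    · exact hn i (by omega)
  · intro i _ hi
    rw [mem_range] at hi
    rcases le_total m n with h | h
    · exact hm i (by omega)
    · exact hn i (by omega)

theorem leftSum_eq_whippleSum {q a c : ℂ} (hq : q ≠ 0) (ha : a ≠ 0) (hc : c ≠ 0)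
    (haq : QGeneric q (a ^ 2)) (hcq : QGeneric q (c ^ 2)) (hacq : QGeneric q ((a * c) ^ 2))
    (hcaq : QGeneric q ((c / a) ^ 2)) (n ℓ m : ℕ) (hn : qShift q q n ≠ 0) :
    leftSum q n ℓ m a c = qFrac q [-a, q ^ m * c ^ 2] [-(a * c), q ^ m * c] n *
      whippleSum q a c (q ^ ℓ) (q ^ m) n := by
  have z : q ^ (1 - n : ℤ) ≠ 0 := zpow_ne_zero _ hq
  have zl : q ^ ℓ ≠ 0 := pow_ne_zero _ hq
  have zm : q ^ m ≠ 0 := pow_ne_zero _ hq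
  have z1 : q ^ (1 - ℓ - n : ℤ) = q ^ (1 - n : ℤ) / q ^ ℓ := by
    rw [← zpow_natCast q ℓ, ← zpow_sub₀ hq]; congr 1; ring
  have z2 : q ^ (1 - m - n : ℤ) = q ^ (1 - n : ℤ) / q ^ m := by
    rw [← zpow_natCast q m, ← zpow_sub₀ hq]; congr 1; ring
  have z3 : q ^ (1 - ℓ - m - n : ℤ) = q ^ (1 - n : ℤ) / (q ^ ℓ * q ^ m) := by
    rw [← zpow_natCast q m, ← zpow_natCast q ℓ, ← zpow_add₀ hq, ← zpow_sub₀ hq]; congr 1; ring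
  have hyc : QGeneric q (q ^ m * c) := hcq.of_sq.shift hq m (by rw [zpow_natCast, mul_comm])
  have hyc2 : QGeneric q (q ^ m * c ^ 2) := hcq.shift hq m (by rw [zpow_natCast, mul_comm])
  have e1 : q ^ (1 - ℓ - n : ℤ) / a / a = q ^ (1 - n : ℤ) / (q ^ ℓ * a ^ 2) := by
    rw [z1]; field_simp
  have e2 : q ^ (1 - ℓ - n : ℤ) / a / (-(q ^ (1 - ℓ - m - n : ℤ) / (a * c))) = -(q ^ m * c) := by
    rw [z1, z3]; field_simp
  have e3 : q ^ (1 - n : ℤ) / (q ^ (1 - m - n : ℤ) / c / c) = q ^ m * c ^ 2 := by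
    rw [z2]; field_simp
  have e4 : q ^ (1 - n : ℤ) / (-(a * c) / c) = -(q ^ (1 - n : ℤ) / a) := by field_simp
  have e5 : q ^ (1 - ℓ - n : ℤ) / a = q ^ (1 - n : ℤ) / (q ^ ℓ * a) := by rw [z1]; field_simp
  have e6 : -(a * c) / c = -a := by field_simp
  have e7 : q ^ (1 - m - n : ℤ) / c / c = q ^ (1 - n : ℤ) / (q ^ m * c ^ 2) := by
    rw [z2]; field_simp
  have e8 : q ^ (1 - m - n : ℤ) / c = q ^ (1 - n : ℤ) / (q ^ m * c) := by rw [z2]; field_simp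
  have key := sears (A := c) (B := a) (C := -(q ^ (1 - ℓ - m - n : ℤ) / (a * c)))
    (D := q ^ (1 - ℓ - n : ℤ) / a) (E := q ^ (1 - m - n : ℤ) / c) (F := -(a * c)) hq hc ha
    (neg_ne_zero.2 (div_ne_zero (zpow_ne_zero _ hq) (mul_ne_zero ha hc)))
    (div_ne_zero (zpow_ne_zero _ hq) ha) (div_ne_zero (zpow_ne_zero _ hq) hc)
    (neg_ne_zero.2 (mul_ne_zero ha hc))
    (haq.of_sq.inv.shift hq (1 - ℓ - n) (by rw [div_eq_mul_inv, mul_comm]))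
    (hcq.of_sq.inv.shift hq (1 - m - n) (by rw [div_eq_mul_inv, mul_comm]))
    hacq.neg_of_sq
    (hcaq.neg_of_sq.inv.shift hq (-m) (by
      rw [z1, z3, zpow_neg, zpow_natCast]; field_simp))
    (e7 ▸ hyc2.inv.shift hq (1 - n) (by rw [div_eq_mul_inv, mul_comm]))
    (e6 ▸ haq.neg_of_sq) n (by rw [z1, z2, z3]; field_simp) hn
  rw [e1, e2, e3, e4, e6, e7] at key
  have R := qShift_reverse_div hq (mul_ne_zero zm (pow_ne_zero 2 hc)) (mul_ne_zero zm hc) (le_refl n)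
    (hyc2.qShift_ne_zero n) (hyc.qShift_ne_zero n)
  rw [Nat.sub_self, qShift_zero, qShift_zero, mul_one, one_mul,
    show q ^ m * c / (q ^ m * c ^ 2) = c⁻¹ by field_simp, inv_pow] at R
  have hcn := pow_ne_zero n hc
  have P : qShift q (q ^ (1 - n : ℤ) / (q ^ m * c ^ 2)) n * qShift q (-a) n /
      (qShift q (q ^ (1 - m - n : ℤ) / c) n * qShift q (-(a * c)) n) * c ^ n =
      qFrac q [-a, q ^ m * c ^ 2] [-(a * c), q ^ m * c] n := by
    rw [e8, mul_div_mul_comm, R]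
    simp only [qFrac, List.map_cons, List.map_nil, List.prod_cons, List.prod_nil, mul_one]
    rw [mul_comm (qShift q (-(a * c)) n), mul_comm (qShift q (-a) n), mul_div_mul_comm _ (qShift q (-a) n)]
    field_simp
  rw [← P, whippleSum, ← e5, leftSum]
  convert key using 1
  · refine sum_congr rfl fun k _ => ?_
    simp only [qFrac, List.map_cons, List.map_nil, List.prod_cons, List.prod_nil, mul_one]
    ring
  · congr 1
    refine sum_congr rfl fun k _ => ?_
    ring

/-! ### The identity for generic parameters -/

/-- The first prefactor with the roles of `n` and `ℓ` interchanged. -/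
theorem qFrac_prefactor {q a : ℂ} (hq : q ≠ 0) (haq : QGeneric q (a ^ 2)) (n ℓ : ℕ) :
    qFrac q [a, q ^ n * a ^ 2] [a ^ 2, q ^ n * a] ℓ =
      qShift q (q ^ ℓ * a ^ 2) n * qShift q a n /
        (qShift q (a ^ 2) n * qShift q (q ^ ℓ * a) n) := by
  have h1 : qShift q (a ^ 2) n * qShift q (q ^ n * a ^ 2) ℓ =
      qShift q (a ^ 2) ℓ * qShift q (q ^ ℓ * a ^ 2) n := by
    rw [mul_comm (q ^ n), mul_comm (q ^ ℓ), ← qShift_add, ← qShift_add, add_comm]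
  have h2 : qShift q a n * qShift q (q ^ n * a) ℓ = qShift q a ℓ * qShift q (q ^ ℓ * a) n := by
    rw [mul_comm (q ^ n), mul_comm (q ^ ℓ), ← qShift_add, ← qShift_add, add_comm]
  have t1 := haq.qShift_ne_zero n
  have t2 := haq.qShift_ne_zero ℓ
  have t3 : qShift q (q ^ n * a) ℓ ≠ 0 :=
    (haq.of_sq.shift hq n (by rw [zpow_natCast, mul_comm])).qShift_ne_zero ℓ
  have t4 : qShift q (q ^ ℓ * a) n ≠ 0 :=
    (haq.of_sq.shift hq ℓ (by rw [zpow_natCast, mul_comm])).qShift_ne_zero n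
  simp only [qFrac, List.map_cons, List.map_nil, List.prod_cons, List.prod_nil, mul_one]
  rw [div_eq_div_iff (mul_ne_zero t2 t3) (mul_ne_zero t1 t4)]
  linear_combination (qShift q a ℓ * qShift q (q ^ ℓ * a) n) * h1 -
    (qShift q (a ^ 2) ℓ * qShift q (q ^ ℓ * a ^ 2) n) * h2

/-- A summand on the right is the product of the two expansion coefficients and a `watsonSum`. -/
theorem rightTerm_eq {q a c : ℂ} (hq : q ≠ 0) (ha : a ≠ 0) (hc : c ≠ 0)
    (haq : QGeneric q (a ^ 2)) (hcq : QGeneric q (c ^ 2)) (i j N ℓ m : ℕ)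
    (hN : qShift q q N ≠ 0) :
    rightTerm q (i + j + N) ℓ m i j a c =
      (1 - q⁻¹ * a ^ 2 * q ^ (2 * i)) / (1 - q⁻¹ * a ^ 2) *
        (qShift q (q⁻¹ * a ^ 2) i * qShift q (q ^ ℓ)⁻¹ i *
          qShift q (q ^ (-(i + j + N : ℕ) : ℤ)) i) /
        (qShift q q i * qShift q (q ^ ℓ * a ^ 2) i * qShift q (q ^ (i + j + N) * a ^ 2) i) *
          (q ^ ℓ * a * q ^ (i + j + N)) ^ i *
      (c ^ j * (q ^ m) ^ j * q ^ (j.choose 2 + j) *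
        ((qShift q (q ^ m)⁻¹ j * qShift q (q ^ (-(j + N : ℕ) : ℤ)) j *
          qShift q (q ^ (1 - (j + N : ℕ) : ℤ) / (q ^ i * a) ^ 2) j *
          qShift q c j * qShift q (-c) j) /
        (qShift q q j * qShift q (q ^ (1 - (j + N : ℕ) : ℤ) / (q ^ i * a)) j *
          qShift q (-(q ^ (1 - (j + N : ℕ) : ℤ) / (q ^ i * a))) j *
          qShift q (q ^ m * c ^ 2) j * qShift q (q ^ (j - 1 : ℤ) * c ^ 2) j)) *
        watsonSum q ((q ^ (1 - (j + N : ℕ) : ℤ) / (q ^ i * a) * q ^ j) ^ 2) ((c * q ^ j) ^ 2) N) := by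
  have hqi : q ^ i ≠ 0 := pow_ne_zero _ hq
  have hqj : q ^ j ≠ 0 := pow_ne_zero _ hq
  have z1 : q ^ (1 - (j + N : ℕ) : ℤ) = q ^ (1 - (i + j + N : ℕ) : ℤ) * q ^ i := by
    rw [← zpow_natCast q i, ← zpow_add₀ hq]; congr 1; push_cast; ring
  have z2 : q ^ (1 - (i + j + N : ℕ) : ℤ) = q ^ (1 - (i + j + N : ℕ) - i : ℤ) * q ^ i := by
    rw [← zpow_natCast q i, ← zpow_add₀ hq]; congr 1; push_cast; ring
  have e1 : q ^ (1 - (j + N : ℕ) : ℤ) / (q ^ i * a) = q ^ (1 - (i + j + N : ℕ) : ℤ) / a := by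
    rw [z1]; field_simp
  have e2 : q ^ (1 - (j + N : ℕ) : ℤ) / (q ^ i * a) ^ 2 =
      q ^ (1 - (i + j + N : ℕ) - i : ℤ) / a ^ 2 := by
    rw [z1, z2]; field_simp
  have e3 : (q ^ (1 - (i + j + N : ℕ) : ℤ) / a * q ^ j) ^ 2 =
      q ^ (2 - 2 * (i + j + N : ℕ) + 2 * j : ℤ) / a ^ 2 := by
    rw [show (2 - 2 * (i + j + N : ℕ) + 2 * j : ℤ) =
      (1 - (i + j + N : ℕ)) + (1 - (i + j + N : ℕ)) + j + j by ring, zpow_add₀ hq, zpow_add₀ hq,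
      zpow_add₀ hq, zpow_natCast]
    ring
  have hu : QGeneric q (q ^ (2 - 2 * (i + j + N : ℕ) + 2 * j : ℤ) / a ^ 2) :=
    haq.inv.shift hq _ (by rw [div_eq_mul_inv, mul_comm])
  have hv : QGeneric q ((c * q ^ j) ^ 2) :=
    hcq.shift hq (2 * j : ℕ) (by rw [zpow_natCast]; ring)
  rw [e1, e2, e3]
  rcases Nat.even_or_odd' N with ⟨s, rfl | rfl⟩
  · have f1 : ((i + j + 2 * s : ℕ) - i - j : ℤ) = (2 * s : ℕ) := by push_cast; ring
    have f2 : i + j + 2 * s - i - j = 2 * s := by omega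
    have f3 : (i - (i + j + 2 * s : ℕ) : ℤ) = -(j + 2 * s : ℕ) := by push_cast; ring
    have f4 : q ^ (2 * i - 1 : ℤ) * a ^ 2 = q⁻¹ * a ^ 2 * q ^ (2 * i) := by
      rw [zpow_sub_one₀ hq, ← zpow_natCast q (2 * i)]; push_cast; ring
    have f5 : q ^ (2 - 2 * (i + j + 2 * s : ℕ) + 2 * j : ℤ) / a ^ 2 / (c * q ^ j) ^ 2 =
        q ^ (2 - 2 * (i + j + 2 * s : ℕ) : ℤ) / (a ^ 2 * c ^ 2) := by
      rw [zpow_add₀ hq, show q ^ (2 * j : ℤ) = (q ^ j) ^ 2 by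
        rw [← pow_mul, ← zpow_natCast]; push_cast; rw [mul_comm]]
      field_simp
    have f6 : (c * q ^ j) ^ 2 * q = q ^ (1 + 2 * j) * c ^ 2 := by ring
    have f7 : q ^ ((ℓ + (i + j + 2 * s : ℕ)) * i + (m + (i + j + 2 * s : ℕ) - i) * j -
        (j.choose 2 : ℕ) : ℤ) * a ^ i * c ^ ((i + j + 2 * s : ℕ) - i : ℤ) =
        (q ^ ℓ * a * q ^ (i + j + 2 * s)) ^ i * (c ^ j * (q ^ m) ^ j * q ^ (j.choose 2 + j)) *
          ((c * q ^ j) ^ 2) ^ s := by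
      have g1 : ((ℓ + (i + j + 2 * s : ℕ)) * i + (m + (i + j + 2 * s : ℕ) - i) * j -
          (j.choose 2 : ℕ) : ℤ) =
          ((ℓ + (i + j + 2 * s)) * i + m * j + (j.choose 2 + j) + 2 * s * j : ℕ) := by
        have h : (j.choose 2 * 2 + j : ℤ) = j * j := mod_cast choose_two_mul_two_add j
        push_cast
        linear_combination -h
      have g2 : ((i + j + 2 * s : ℕ) - i : ℤ) = (j + 2 * s : ℕ) := by push_cast; ring
      rw [g1, g2, zpow_natCast, zpow_natCast]
      ring
    rw [watsonSum_even hq (pow_ne_zero 2 (mul_ne_zero hc hqj)) hu hv s hN, rightTerm, f1, f2,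
      parityChi_even, f3, f4, f5, f6, f7, Nat.mul_div_cancel_left _ two_pos]
    simp only [qFrac, List.map_cons, List.map_nil, List.prod_cons, List.prod_nil, mul_one,
      zpow_neg_one, zpow_neg q ℓ, zpow_neg q m, zpow_natCast]
    simp only [div_eq_mul_inv, mul_inv]
    ring
  · rw [watsonSum_odd hq hu hv s hN, mul_zero, mul_zero]
    exact rightTerm_eq_zero hq a c (Or.inr (Or.inr (Or.inr ⟨s, rfl⟩)))

theorem leftSum_eq_rightSum_of_generic {q a c : ℂ} (hq : q ≠ 0) (ha : a ≠ 0) (hc : c ≠ 0)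
    (haq : QGeneric q (a ^ 2)) (hcq : QGeneric q (c ^ 2)) (hacq : QGeneric q ((a * c) ^ 2))
    (hcaq : QGeneric q ((c / a) ^ 2)) (n ℓ m : ℕ) (hn : qShift q q n ≠ 0) :
    leftSum q n ℓ m a c = rightSum q n ℓ m a c := by
  have hR : rightSum q n ℓ m a c = qFrac q [a, q ^ n * a ^ 2] [a ^ 2, q ^ n * a] ℓ *
      qFrac q [-a, q ^ m * c ^ 2] [-(a * c), q ^ m * c] n *
      ∑ i ∈ range (n + 1), ∑ j ∈ range (n - i + 1), rightTerm q n ℓ m i j a c := by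
    rw [rightSum]
    congr 1
    rw [sum_range_succ_eq_of_eq_zero (n := n)
      (fun i hi => sum_eq_zero fun j _ => rightTerm_eq_zero hq a c (Or.inl hi))
      (fun i hi => sum_eq_zero fun j _ => rightTerm_eq_zero hq a c (by omega))]
    refine sum_congr rfl fun i hi => sum_range_succ_eq_of_eq_zero
      (fun j hj => rightTerm_eq_zero hq a c (by omega))
      (fun j hj => rightTerm_eq_zero hq a c (by omega))
  rw [hR, leftSum_eq_whippleSum hq ha hc haq hcq hacq hcaq n ℓ m hn,
    whippleSum_eq_sum_whippleSum_one hq ha (pow_ne_zero ℓ hq) haq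
      (haq.of_sq.shift hq ℓ (by rw [zpow_natCast, mul_comm]))
      (haq.shift hq ℓ (by rw [zpow_natCast, mul_comm])) n hn,
    qFrac_prefactor hq haq, mul_left_comm, ← mul_assoc]
  congr 1
  refine sum_congr rfl fun i hi => ?_
  rw [whippleSum_one_eq_sum_watsonSum hq hc (pow_ne_zero m hq) hcq
      (hcq.shift hq m (by rw [zpow_natCast, mul_comm])) (n - i)
      (qShift_ne_zero_of_le hn (Nat.sub_le n i)), mul_sum]
  refine sum_congr rfl fun j hj => ?_
  obtain ⟨N, rfl⟩ : ∃ N, n = i + j + N := Nat.exists_eq_add_of_le (by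
    have := mem_range.1 hj
    have := mem_range.1 hi
    omega)
  rw [rightTerm_eq hq ha hc haq hcq i j N ℓ m
    (qShift_ne_zero_of_le hn (Nat.le_add_left _ _)), show i + j + N - i = j + N by omega,
    show j + N - j = N by omega]

/-! ### Removal of the genericity assumption -/

theorem continuousAt_qShift (q : ℂ) (n : ℕ) {f : ℂ → ℂ} {t : ℂ} (hf : ContinuousAt f t) :
    ContinuousAt (fun s => qShift q (f s) n) t := by
  simp only [qShift]
  fun_prop

theorem continuousAt_qFrac (q : ℂ) (n : ℕ) (num den : List (ℂ → ℂ)) {t : ℂ}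
    (hnum : ∀ f ∈ num, ContinuousAt f t) (hden : ∀ f ∈ den, ContinuousAt f t)
    (h : NoZeroFactor q (den.map fun f => f t) n) :
    ContinuousAt (fun s => qFrac q (num.map fun f => f s) (den.map fun f => f s) n) t := by
  have aux : ∀ l : List (ℂ → ℂ), (∀ f ∈ l, ContinuousAt f t) →
      ContinuousAt (fun s => ((l.map fun f => f s).map fun x => qShift q x n).prod) t := by
    intro l hl
    induction l with
    | nil => simpa using continuousAt_const
    | cons f l ih =>
      simp only [List.map_cons, List.prod_cons]
      exact (continuousAt_qShift q n (hl f List.mem_cons_self)).mul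
        (ih fun g hg => hl g (List.mem_cons_of_mem _ hg))
  refine (aux num hnum).div (aux den hden) ?_
  intro h0
  obtain ⟨x, hx, hx0⟩ := List.mem_map.1 (List.prod_eq_zero_iff.1 h0)
  exact h x hx hx0

/-- For each `r` only finitely many `t` satisfy `b t^d q^r = 1`. -/
theorem countable_setOf_not_qGeneric {q b : ℂ} {d : ℕ} (hd : 0 < d) :
    {t : ℂ | ¬ QGeneric q (b * t ^ d)}.Countable := by
  have : {t : ℂ | ¬ QGeneric q (b * t ^ d)} ⊆
      ⋃ r : ℤ, ((Polynomial.nthRoots d (b * q ^ r)⁻¹).toFinset : Set ℂ) := by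
    intro t ht
    simp only [QGeneric, Set.mem_ofPred_eq, not_forall, not_not] at ht
    obtain ⟨r, hr⟩ := ht
    refine Set.mem_iUnion.2 ⟨r, ?_⟩
    rw [Finset.mem_coe, Multiset.mem_toFinset, Polynomial.mem_nthRoots hd]
    exact eq_inv_of_mul_eq_one_left (by rw [← hr]; ring)
  exact (Set.countable_iUnion fun r => Finset.countable_toSet _).mono this

theorem continuousAt_leftSum {q t : ℂ} {n ℓ m : ℕ} {f g : ℂ → ℂ} (hf : ContinuousAt f t)
    (hg : ContinuousAt g t) (hf0 : f t ≠ 0) (hg0 : g t ≠ 0)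
    (hleft : NoZeroFactor q
      [q, q ^ (1 - ℓ - n : ℤ) / f t, q ^ (1 - m - n : ℤ) / g t, -(f t * g t)] n) :
    ContinuousAt (fun s => leftSum q n ℓ m (f s) (g s)) t := by
  refine tendsto_finsetSum _ fun k hk => ContinuousAt.mul ?_ continuousAt_const
  have hk' : k ≤ n := Nat.lt_succ_iff.1 (mem_range.1 hk)
  refine continuousAt_qFrac q k
    [fun _ => q ^ (-n : ℤ), f, g, fun s => -(q ^ (1 - ℓ - m - n : ℤ) / (f s * g s))]
    [fun _ => q, fun s => q ^ (1 - ℓ - n : ℤ) / f s, fun s => q ^ (1 - m - n : ℤ) / g s,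
      fun s => -(f s * g s)] ?_ ?_ fun x hx => qShift_ne_zero_of_le (hleft x hx) hk'
  · simp only [List.forall_mem_cons, List.not_mem_nil, false_imp_iff, implies_true, and_true]
    exact ⟨continuousAt_const, hf, hg,
      (continuousAt_const.div (hf.mul hg) (mul_ne_zero hf0 hg0)).neg⟩
  · simp only [List.forall_mem_cons, List.not_mem_nil, false_imp_iff, implies_true, and_true]
    exact ⟨continuousAt_const, continuousAt_const.div hf hf0, continuousAt_const.div hg hg0,
      (hf.mul hg).neg⟩

/-- Denominators are assumed nonzero only for the summands that are present; the others vanish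
identically. -/
theorem continuousAt_rightTerm {q t : ℂ} {n ℓ m i j : ℕ} {f g : ℂ → ℂ} (hq : q ≠ 0)
    (hf : ContinuousAt f t) (hg : ContinuousAt g t) (hf0 : f t ≠ 0) (hg0 : g t ≠ 0)
    (hright : ∀ s : ℕ, i + j + 2 * s = n →
      1 - q ^ (-1 : ℤ) * f t ^ 2 ≠ 0 ∧
      NoZeroFactor q [q, q ^ n * f t ^ 2, q ^ ℓ * f t ^ 2] i ∧
      NoZeroFactor q [q, q ^ (1 - n : ℤ) / f t, -(q ^ (1 - n : ℤ) / f t), q ^ m * g t ^ 2,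
        q ^ (j - 1 : ℤ) * g t ^ 2] j ∧
      NoZeroFactor (q ^ 2)
        [q ^ (2 - 2 * n + 2 * j : ℤ) / f t ^ 2, q ^ (1 + 2 * j) * g t ^ 2] s) :
    ContinuousAt (fun s => rightTerm q n ℓ m i j (f s) (g s)) t := by
  by_cases h : ∃ s, i + j + 2 * s = n
  · obtain ⟨s, hs⟩ := h
    obtain ⟨h1, h2, h3, h4⟩ := hright s hs
    have hs' : (n - i - j) / 2 = s := by omega
    have hf2 : ContinuousAt (fun s => f s ^ 2) t := hf.pow 2
    have hg2 : ContinuousAt (fun s => g s ^ 2) t := hg.pow 2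
    have hf20 : f t ^ 2 ≠ 0 := pow_ne_zero 2 hf0
    have hg20 : g t ^ 2 ≠ 0 := pow_ne_zero 2 hg0
    have hc : ∀ b : ℂ, ContinuousAt (fun _ : ℂ => b) t := fun b => continuousAt_const
    simp only [rightTerm, hs']
    refine ContinuousAt.mul (ContinuousAt.mul (ContinuousAt.mul (ContinuousAt.mul
      (ContinuousAt.mul (ContinuousAt.mul ((hc _).mul (hf.pow i)) (hg.zpow₀ _ (Or.inl hg0)))
        (((hc 1).sub ((hc _).mul hf2)).div ((hc 1).sub ((hc _).mul hf2)) h1)) ?_) ?_) ?_) (hc _)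
    · refine continuousAt_qFrac q i
        [fun _ => q ^ (-ℓ : ℤ), fun _ => q ^ (-n : ℤ), fun s => q ^ (-1 : ℤ) * f s ^ 2]
        [fun _ => q, fun s => q ^ n * f s ^ 2, fun s => q ^ ℓ * f s ^ 2] ?_ ?_ h2 <;>
        simp only [List.forall_mem_cons, List.not_mem_nil, false_imp_iff, implies_true, and_true]
      · exact ⟨hc _, hc _, (hc _).mul hf2⟩
      · exact ⟨hc _, (hc _).mul hf2, (hc _).mul hf2⟩
    · refine continuousAt_qFrac q j
        [fun _ => q ^ (-m : ℤ), fun _ => q ^ (i - n : ℤ), fun s => q ^ (1 - n - i : ℤ) / f s ^ 2,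
          g, fun s => -g s]
        [fun _ => q, fun s => q ^ (1 - n : ℤ) / f s, fun s => -(q ^ (1 - n : ℤ) / f s),
          fun s => q ^ m * g s ^ 2, fun s => q ^ (j - 1 : ℤ) * g s ^ 2] ?_ ?_ h3 <;>
        simp only [List.forall_mem_cons, List.not_mem_nil, false_imp_iff, implies_true, and_true]
      · exact ⟨hc _, hc _, (hc _).div hf2 hf20, hg, hg.neg⟩
      · exact ⟨hc _, (hc _).div hf hf0, ((hc _).div hf hf0).neg, (hc _).mul hg2, (hc _).mul hg2⟩
    · refine continuousAt_qFrac (q ^ 2) s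
        [fun _ => q, fun s => q ^ (2 - 2 * n : ℤ) / (f s ^ 2 * g s ^ 2)]
        [fun s => q ^ (2 - 2 * n + 2 * j : ℤ) / f s ^ 2, fun s => q ^ (1 + 2 * j) * g s ^ 2]
        ?_ ?_ h4 <;>
        simp only [List.forall_mem_cons, List.not_mem_nil, false_imp_iff, implies_true, and_true]
      · exact ⟨hc _, (hc _).div (hf2.mul hg2) (mul_ne_zero hf20 hg20)⟩
      · exact ⟨(hc _).div hf2 hf20, (hc _).mul hg2⟩
  · have h0 : ∀ a c : ℂ, rightTerm q n ℓ m i j a c = 0 := fun a c => by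
      refine rightTerm_eq_zero hq a c (Or.inr (Or.inr ?_))
      rcases lt_or_ge n (i + j) with hlt | hge
      · exact Or.inl hlt
      · obtain ⟨d, rfl⟩ := Nat.exists_eq_add_of_le hge
        rcases Nat.even_or_odd' d with ⟨s, rfl | rfl⟩
        · exact absurd ⟨s, rfl⟩ h
        · exact Or.inr ⟨s, rfl⟩
    simp only [h0]
    exact continuousAt_const

theorem continuousAt_rightSum {q t : ℂ} {n ℓ m : ℕ} {f g : ℂ → ℂ} (hq : q ≠ 0)
    (hf : ContinuousAt f t) (hg : ContinuousAt g t) (hf0 : f t ≠ 0) (hg0 : g t ≠ 0)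
    (hpre₁ : NoZeroFactor q [f t ^ 2, q ^ n * f t] ℓ)
    (hpre₂ : NoZeroFactor q [-(f t * g t), q ^ m * g t] n)
    (hright : ∀ i ≤ ℓ, ∀ j ≤ m, ∀ s : ℕ, i + j + 2 * s = n →
      1 - q ^ (-1 : ℤ) * f t ^ 2 ≠ 0 ∧
      NoZeroFactor q [q, q ^ n * f t ^ 2, q ^ ℓ * f t ^ 2] i ∧
      NoZeroFactor q [q, q ^ (1 - n : ℤ) / f t, -(q ^ (1 - n : ℤ) / f t), q ^ m * g t ^ 2,
        q ^ (j - 1 : ℤ) * g t ^ 2] j ∧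
      NoZeroFactor (q ^ 2)
        [q ^ (2 - 2 * n + 2 * j : ℤ) / f t ^ 2, q ^ (1 + 2 * j) * g t ^ 2] s) :
    ContinuousAt (fun s => rightSum q n ℓ m (f s) (g s)) t := by
  have hc : ∀ b : ℂ, ContinuousAt (fun _ : ℂ => b) t := fun b => continuousAt_const
  refine ContinuousAt.mul (ContinuousAt.mul ?_ ?_) ?_
  · refine continuousAt_qFrac q ℓ [f, fun s => q ^ n * f s ^ 2] [fun s => f s ^ 2,
      fun s => q ^ n * f s] ?_ ?_ hpre₁ <;>
      simp only [List.forall_mem_cons, List.not_mem_nil, false_imp_iff, implies_true, and_true]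
    · exact ⟨hf, (hc _).mul (hf.pow 2)⟩
    · exact ⟨hf.pow 2, (hc _).mul hf⟩
  · refine continuousAt_qFrac q n [fun s => -f s, fun s => q ^ m * g s ^ 2]
      [fun s => -(f s * g s), fun s => q ^ m * g s] ?_ ?_ hpre₂ <;>
      simp only [List.forall_mem_cons, List.not_mem_nil, false_imp_iff, implies_true, and_true]
    · exact ⟨hf.neg, (hc _).mul (hg.pow 2)⟩
    · exact ⟨(hf.mul hg).neg, (hc _).mul hg⟩
  · exact tendsto_finsetSum _ fun i hi => tendsto_finsetSum _ fun j hj =>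
      continuousAt_rightTerm hq hf hg hf0 hg0 (hright i (Nat.lt_succ_iff.1 (mem_range.1 hi)) j
        (Nat.lt_succ_iff.1 (mem_range.1 hj)))

/-- The exponents `1` and `3` keep `a²`, `c²`, `a²c²` and `c²/a²` all nonconstant along the curve. -/
theorem dense_setOf_qGeneric (q a c : ℂ) :
    Dense {t : ℂ | t ≠ 0 ∧ QGeneric q ((a * t) ^ 2) ∧ QGeneric q ((c * t ^ 3) ^ 2) ∧
      QGeneric q ((a * t * (c * t ^ 3)) ^ 2) ∧ QGeneric q ((c * t ^ 3 / (a * t)) ^ 2)} := by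
  have h := ((((Set.countable_singleton (0 : ℂ)).union
    (countable_setOf_not_qGeneric (q := q) (b := a ^ 2) (d := 2) (by norm_num))).union
    (countable_setOf_not_qGeneric (q := q) (b := c ^ 2) (d := 6) (by norm_num))).union
    (countable_setOf_not_qGeneric (q := q) (b := a ^ 2 * c ^ 2) (d := 8) (by norm_num))).union
    (countable_setOf_not_qGeneric (q := q) (b := c ^ 2 / a ^ 2) (d := 4) (by norm_num))
  refine (h.dense_compl ℝ).mono fun t ht => ?_
  simp only [Set.mem_compl_iff, Set.mem_union, Set.mem_singleton_iff, Set.mem_ofPred_eq, not_or,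
    not_not] at ht
  obtain ⟨⟨⟨⟨h0, h1⟩, h2⟩, h3⟩, h4⟩ := ht
  refine ⟨h0, ?_, ?_, ?_, ?_⟩
  · convert h1 using 1; ring
  · convert h2 using 1; ring
  · convert h3 using 1; ring
  · convert h4 using 1; field_simp

theorem theorem6 (q a c : ℂ) (n ℓ m : ℕ) (hq : q ≠ 0) (ha : a ≠ 0) (hc : c ≠ 0)
    -- no zero factors in the denominators of the (terminating) series on the left
    (hleft : NoZeroFactor q
      [q, q ^ (1 - ℓ - n : ℤ) / a, q ^ (1 - m - n : ℤ) / c, -(a * c)] n)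
    -- no zero factors in the denominators of the prefactor on the right
    (hpre₁ : NoZeroFactor q [a ^ 2, q ^ n * a] ℓ)
    (hpre₂ : NoZeroFactor q [-(a * c), q ^ m * c] n)
    -- no zero factors in the denominators of the summands on the right that are present,
    -- i.e. those with `n - i - j = 2 s`, `s ≥ 0`
    (hright : ∀ i ≤ ℓ, ∀ j ≤ m, ∀ s : ℕ, i + j + 2 * s = n →
      1 - q ^ (-1 : ℤ) * a ^ 2 ≠ 0 ∧
      NoZeroFactor q [q, q ^ n * a ^ 2, q ^ ℓ * a ^ 2] i ∧
      NoZeroFactor q [q, q ^ (1 - n : ℤ) / a, -(q ^ (1 - n : ℤ) / a), q ^ m * c ^ 2,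
        q ^ (j - 1 : ℤ) * c ^ 2] j ∧
      NoZeroFactor (q ^ 2) [q ^ (2 - 2 * n + 2 * j : ℤ) / a ^ 2, q ^ (1 + 2 * j) * c ^ 2] s) :
    basicHyp q q
        [q ^ (-n : ℤ), a, c, -(q ^ (1 - ℓ - m - n : ℤ) / (a * c))]
        [q ^ (1 - ℓ - n : ℤ) / a, q ^ (1 - m - n : ℤ) / c, -(a * c)] =
      qFrac q [a, q ^ n * a ^ 2] [a ^ 2, q ^ n * a] ℓ *
      qFrac q [-a, q ^ m * c ^ 2] [-(a * c), q ^ m * c] n *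
      ∑ i ∈ Finset.range (ℓ + 1), ∑ j ∈ Finset.range (m + 1),
        q ^ ((ℓ + n) * i + (m + n - i) * j - (j.choose 2 : ℕ) : ℤ) *
        a ^ i * c ^ (n - i : ℤ) *
        ((1 - q ^ (2 * i - 1 : ℤ) * a ^ 2) / (1 - q ^ (-1 : ℤ) * a ^ 2)) *
        qFrac q
          [q ^ (-ℓ : ℤ), q ^ (-n : ℤ), q ^ (-1 : ℤ) * a ^ 2]
          [q, q ^ n * a ^ 2, q ^ ℓ * a ^ 2] i *
        qFrac q
          [q ^ (-m : ℤ), q ^ (i - n : ℤ), q ^ (1 - n - i : ℤ) / a ^ 2, c, -c]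
          [q, q ^ (1 - n : ℤ) / a, -(q ^ (1 - n : ℤ) / a), q ^ m * c ^ 2,
            q ^ (j - 1 : ℤ) * c ^ 2] j *
        qFrac (q ^ 2)
          [q, q ^ (2 - 2 * n : ℤ) / (a ^ 2 * c ^ 2)]
          [q ^ (2 - 2 * n + 2 * j : ℤ) / a ^ 2, q ^ (1 + 2 * j) * c ^ 2]
          ((n - i - j) / 2) *
        parityChi (n - i - j : ℤ) := by
  rw [basicHyp_eq_leftSum hq]
  change leftSum q n ℓ m a c = rightSum q n ℓ m a c
  have hn : qShift q q n ≠ 0 := hleft q List.mem_cons_self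
  -- Approach `(a, c)` along `(a t, c t³)`, `t → 1`, through generic parameters.
  have hf : ContinuousAt (fun t : ℂ => a * t) 1 := by fun_prop
  have hg : ContinuousAt (fun t : ℂ => c * t ^ 3) 1 := by fun_prop
  have ea : a * 1 = a := mul_one a
  have ec : c * 1 ^ 3 = c := by rw [one_pow, mul_one]
  have hL := continuousAt_leftSum (q := q) (n := n) (ℓ := ℓ) (m := m) hf hg
    (by rwa [ea]) (by rwa [ec]) (by rwa [ea, ec])
  have hR := continuousAt_rightSum (q := q) (n := n) (ℓ := ℓ) (m := m) hq hf hg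
    (by rwa [ea]) (by rwa [ec]) (by rwa [ea]) (by rwa [ea, ec]) (by rwa [ea, ec])
  have hfreq := mem_closure_iff_frequently.1 (dense_setOf_qGeneric q a c 1)
  have key := tendsto_nhds_unique_of_frequently_eq hL hR (hfreq.mono fun t ht =>
    leftSum_eq_rightSum_of_generic hq (mul_ne_zero ha ht.1)
      (mul_ne_zero hc (pow_ne_zero 3 ht.1)) ht.2.1 ht.2.2.1 ht.2.2.2.1 ht.2.2.2.2 n ℓ m hn)
  simpa only [ea, ec] using key
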